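/- Setting. For a graph \(G=(V,E)\) on \(V=\{1,\dots,p\}\) and \(\lambda>0\), let \(P_G(x)=\frac1Z\exp\big(\lambda\sum_{\{i,j\}\in E}x_ix_j\big)\), \(x\in\{-1,1\}^p\), be the ferromagnetic Ising model, where \(Z\) is the normalizing constant. Let \(\mathcal G_{k,d}\) be the class of graphs on \(V\) with at most \(k\) edges and all degrees at most \(d\). A (possibly randomized) decoder observes \(n\) independent samples from \(P_G\) and outputs an estimate \(\hat E\) of \(E\). For a distortion level \(q_{\max}\) put \(P_e(q_{\max})=\max_{G\in\mathcal G_{k,d}}\mathbb P_G\big[|E\,\triangle\,\hat E|>q_{\max}\big]\). Let \(H_2(\theta)=-\theta\log\theta-(1-\theta)\log(1-\theta)\), with natural logarithms. Theorem. Let \(\theta>0\) be a constant and let \(k=k_p\), \(d=d_p\), \(d'=d'_p\) be sequences of non-negative integers such that, for all sufficiently large \(p\), \(d>2\), \(\theta<\frac14\cdot\frac{d-2}{d}\), \(d'\le d\) and \(k\le\frac12p(d'-1)\), and such that \(k/d^2\to\infty\) as \(p\to\infty\) (i.e. \(k=\omega(d^2)\)). Let \(q_{\max}=\lfloor\theta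 k\rfloor\). Then there is a sequence \(r_p\to0\), depending only on \(\theta\) and on the sequences \(k,d,d'\), such that for all sufficiently large \(p\), all \(\lambda>0\), all \(\delta\in\mathbb R\), all \(n\ge0\) and every decoder based on \(n\) samples, if \(P_e(q_{\max})\le\delta\), then \[ n\ \ge\ \max\left\{\frac{e^{\lambda(d-2)/4}\big(\log2-H_2\big(\frac{d}{d-2}\cdot2\theta\big)\big)}{3\lambda d^2},\ \frac{\log2-H_2(\theta)}{\lambda\,\frac{e^{2\lambda}\cosh(2\lambda d')-1}{e^{2\lambda}\cosh(2\lambda d')+1}}\right\}\,(1-\delta-r_p). \] -/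

import Mathlib

open Filter Topology

noncomputable section

namespace IsingSelection

/-- A configuration of `p` spins, each in `{-1, 1}` (`ℤˣ` is exactly `{1, -1}`). -/
abbrev Config (p : ℕ) : Type := Fin p → ℤˣ

/-- The real value `±1` of spin `i`. -/
def spin {p : ℕ} (x : Config p) (i : Fin p) : ℝ := ((x i : ℤ) : ℝ)

open Classical in
/-- The coupling `λ_{ij}`: equal to `lam` on the edges of `G` and `0` otherwise. -/
def coupling {p : ℕ} (lam : ℝ) (G : SimpleGraph (Fin p)) (i j : Fin p) : ℝ :=
  if G.Adj i j then lam else 0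

/-- The exponent `∑ λ_{ij} x_i x_j`, each unordered pair of vertices being counted once. -/
def exponent {p : ℕ} (lam : ℝ) (G : SimpleGraph (Fin p)) (x : Config p) : ℝ :=
  ∑ i : Fin p, ∑ j ∈ Finset.Ioi i, coupling lam G i j * spin x i * spin x j

/-- The partition function. -/
def partitionFunction {p : ℕ} (lam : ℝ) (G : SimpleGraph (Fin p)) : ℝ :=
  ∑ x : Config p, Real.exp (exponent lam G x)

/-- The probability mass function `P_G` of the ferromagnetic Ising model on `G`. -/
def isingProb {p : ℕ} (lam : ℝ) (G : SimpleGraph (Fin p)) (x : Config p) : ℝ :=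
  Real.exp (exponent lam G x) / partitionFunction lam G

/-- The joint probability mass function of `n` independent samples from `P_G`. -/
def sampleProb {p : ℕ} (n : ℕ) (lam : ℝ) (G : SimpleGraph (Fin p))
    (X : Fin n → Config p) : ℝ :=
  ∏ t : Fin n, isingProb lam G (X t)

/-- The edit distance `|E ∆ E'|` between two graphs. -/
def editDist {p : ℕ} (G G' : SimpleGraph (Fin p)) : ℕ :=
  (symmDiff G.edgeSet G'.edgeSet).ncard

/-- The class of graphs on `p` vertices with at most `k` edges and all degrees at most `d`. -/
def graphClass (p k d : ℕ) : Set (SimpleGraph (Fin p)) :=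
  {G | G.edgeSet.ncard ≤ k ∧ ∀ v : Fin p, (G.neighborSet v).ncard ≤ d}

/-- A (possibly randomized) decoder: it maps the `n` samples to the law of the estimated graph.
A deterministic decoder `f` is `fun X => PMF.pure (f X)`. -/
abbrev Decoder (p n : ℕ) : Type := (Fin n → Config p) → PMF (SimpleGraph (Fin p))

open Classical in
/-- `ℙ_G[|E ∆ Ê| > q]` for the given decoder, when the samples are drawn from `P_G`. -/
def errorProb {p n : ℕ} (lam : ℝ) (q : ℕ) (dec : Decoder p n) (G : SimpleGraph (Fin p)) : ℝ :=
  ∑ X : Fin n → Config p, sampleProb n lam G X *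
    ∑ G' : SimpleGraph (Fin p), if q < editDist G G' then (dec X G').toReal else 0

/-- The worst-case error probability over the class of graphs with at most `k` edges and
degrees at most `d` (a maximum over a finite nonempty set). -/
def maxErrorProb {p n : ℕ} (k d : ℕ) (lam : ℝ) (q : ℕ) (dec : Decoder p n) : ℝ :=
  ⨆ G : graphClass p k d, errorProb lam q dec (G : SimpleGraph (Fin p))

end IsingSelection

end

/-! The proof applies Fano's inequality to two ensembles of the same shape: fix edges `F`, and let
`S` range over all subsets of a set `W` of further edges.

*Information.* A decoder that is right up to `q` edges with probability `1 - δ` on all graphs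
`F ∪ S` must receive `(1 - δ) log (2 ^ N / A)` nats, up to `log 2`, where `N = #W` and `A` bounds
the number of subsets of `W` in a Hamming ball of radius `q` (`fano_approx`, `fano_ensemble`).
A Chernoff bound gives `log (2 ^ N / A) ≥ N (log 2 - H₂(q / N))` (`card_ball_mul_exp_le`).
On the other side, `n` samples carry at most `n` times the largest divergence `D(P_{F ∪ S} ‖ P_F)`.
As the symmetrized divergence of two Ising models contains no partition function, that is at most
`lam` times the sum over `S` of the increase of the correlation `𝔼[x_i x_j]` (`klDiv_le_sum_corr`).

*Sparse ensemble.* Here `F = ∅`, and `W` consists of `k` edges of a circulant graph with degrees at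
most `d'`. Without edges the correlations vanish; conditioning on all spins but `x_i` and `x_j`
bounds the correlation along an edge by the quotient of the second bound (`corr_le`).

*Dense ensemble.* Here `F` is a union of disjoint copies of `K_{m,m}` with `m = ⌊(d + 1) / 2⌋`, and
`W` completes each copy to a clique, which makes up a fraction of about `(d - 2) / (2 d)` of the
`k` edges; this rescales the distortion `θ` to `2 θ d / (d - 2)`. Spins in the same copy already
agree under `P_F` except with probability exponentially small in `lam * d`, by a Peierls argument:
`t ≤ m` vertices of `K_{m,m}` have at least `m t / 2` edges to the others
(`one_sub_corr_crossEdges_le`). So adding edges of `W` is barely visible.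

All rounding errors are `O(d ^ 2 / k)` relative to the main terms, uniformly in `lam`, `δ`, `n` and
the decoder. -/

/-! ### Fano's inequality with approximate recovery -/

namespace IsingSelection

open Finset

/-- One step of the Donsker–Varadhan inequality, with the logarithm of the exponential moment
under `Q` replaced by its tangent at `2`. The kernel `D` models a randomized decoder. -/
lemma sum_mul_le_klDiv_add {Ω Γ : Type*} [Fintype Ω] [Fintype Γ] {P Q : Ω → ℝ} {D : Ω → Γ → ℝ}
    (hP : ∀ x, 0 < P x) (hQ : ∀ x, 0 < Q x) (hP1 : ∑ x, P x = 1)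
    (hD : ∀ x y, 0 ≤ D x y) (hD1 : ∀ x, ∑ y, D x y = 1) (f : Γ → ℝ) :
    ∑ x, P x * ∑ y, D x y * f y ≤
      ∑ x, P x * Real.log (P x / Q x) + (1 / 2) * ∑ x, Q x * ∑ y, D x y * Real.exp (f y)
        - 1 + Real.log 2 := by
  have key : ∀ x y, P x * (D x y * f y) ≤ D x y * (P x * Real.log (P x / Q x)) +
      (1 / 2) * (Q x * (D x y * Real.exp (f y))) + D x y * (P x * (Real.log 2 - 1)) := by
    intro x y
    have h1 : 0 < Real.exp (f y) * (Q x / P x) / 2 := by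
      have := hP x; have := hQ x; positivity
    have h2 := Real.log_le_sub_one_of_pos h1
    have hlog : Real.log (Real.exp (f y) * (Q x / P x) / 2)
        = f y - Real.log (P x / Q x) - Real.log 2 := by
      rw [Real.log_div (by have := hP x; have := hQ x; positivity) (by norm_num),
        Real.log_mul (Real.exp_pos _).ne' (by have := hP x; have := hQ x; positivity),
        Real.log_exp, Real.log_div (hQ x).ne' (hP x).ne', Real.log_div (hP x).ne' (hQ x).ne']
      ring
    rw [hlog] at h2
    have h3 := mul_le_mul_of_nonneg_left h2 (mul_nonneg (hD x y) (hP x).le)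
    have h4 : D x y * P x * (Real.exp (f y) * (Q x / P x) / 2 - 1)
        = (1 / 2) * (Q x * (D x y * Real.exp (f y))) - D x y * P x := by
      have := (hP x).ne'
      field_simp
    rw [h4] at h3
    linarith
  have hsum := Finset.sum_le_sum fun x (_ : x ∈ univ) =>
    Finset.sum_le_sum fun y (_ : y ∈ univ) => key x y
  simp only [Finset.sum_add_distrib, ← Finset.mul_sum, ← Finset.sum_mul, hD1, one_mul, hP1]
    at hsum
  linarith

lemma sum_toReal_pmf {α : Type*} [Fintype α] (μ : PMF α) : ∑ a, (μ a).toReal = 1 := by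
  rw [← ENNReal.toReal_sum fun a _ => μ.apply_ne_top a]
  have := μ.tsum_coe
  rw [tsum_fintype] at this
  rw [this]; rfl

lemma partitionFunction_pos {p : ℕ} (lam : ℝ) (G : SimpleGraph (Fin p)) :
    0 < partitionFunction lam G :=
  Finset.sum_pos (fun _ _ => Real.exp_pos _) Finset.univ_nonempty

lemma isingProb_pos {p : ℕ} (lam : ℝ) (G : SimpleGraph (Fin p)) (x : Config p) :
    0 < isingProb lam G x :=
  div_pos (Real.exp_pos _) (partitionFunction_pos _ _)

lemma sum_isingProb {p : ℕ} (lam : ℝ) (G : SimpleGraph (Fin p)) :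
    ∑ x, isingProb lam G x = 1 := by
  simp only [isingProb]
  rw [← Finset.sum_div]
  exact div_self (partitionFunction_pos lam G).ne'

/-- The Kullback–Leibler divergence `D(P_G ‖ P_{G₀})` of two Ising models. -/
noncomputable def klDiv {p : ℕ} (lam : ℝ) (G G₀ : SimpleGraph (Fin p)) : ℝ :=
  ∑ x, isingProb lam G x * Real.log (isingProb lam G x / isingProb lam G₀ x)

lemma sampleProb_pos {p n : ℕ} (lam : ℝ) (G : SimpleGraph (Fin p)) (X : Fin n → Config p) :
    0 < sampleProb n lam G X :=
  Finset.prod_pos fun _ _ => isingProb_pos _ _ _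

lemma sum_sampleProb {p n : ℕ} (lam : ℝ) (G : SimpleGraph (Fin p)) :
    ∑ X, sampleProb n lam G X = 1 := by
  simp only [sampleProb]
  rw [← Fintype.prod_sum (fun (_ : Fin n) x => isingProb lam G x)]
  simp [sum_isingProb]

lemma sum_prod_mul_apply {α : Type*} [Fintype α] {n : ℕ} (P g : α → ℝ) (hP : ∑ x, P x = 1)
    (t₀ : Fin n) : ∑ X : Fin n → α, (∏ t, P (X t)) * g (X t₀) = ∑ x, P x * g x := by
  classical
  have h : ∀ X : Fin n → α, (∏ t, P (X t)) * g (X t₀)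
      = ∏ t, (P (X t) * if t = t₀ then g (X t) else 1) := by
    intro X
    rw [Finset.prod_mul_distrib, Finset.prod_ite_eq' univ t₀ fun t => g (X t)]
    simp
  simp only [h]
  rw [← Fintype.prod_sum (fun (t : Fin n) x => P x * if t = t₀ then g x else 1),
    Finset.prod_eq_single t₀]
  · simp
  · intro t _ ht
    simp [ht, hP]
  · simp

/-- The divergence of product measures is additive. -/
lemma sum_sampleProb_log {p n : ℕ} (lam : ℝ) (G G₀ : SimpleGraph (Fin p)) :
    ∑ X, sampleProb n lam G X * Real.log (sampleProb n lam G X / sampleProb n lam G₀ X)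
      = n * klDiv lam G G₀ := by
  have h : ∀ X : Fin n → Config p,
      sampleProb n lam G X * Real.log (sampleProb n lam G X / sampleProb n lam G₀ X)
      = ∑ t, (∏ t, isingProb lam G (X t)) *
          Real.log (isingProb lam G (X t) / isingProb lam G₀ (X t)) := by
    intro X
    rw [← Finset.mul_sum, ← Real.log_prod, Finset.prod_div_distrib]
    · rfl
    · intro t _
      exact (div_pos (isingProb_pos _ _ _) (isingProb_pos _ _ _)).ne'
  simp only [h]
  rw [Finset.sum_comm]
  simp only [sum_prod_mul_apply (isingProb lam G)
    (fun x => Real.log (isingProb lam G x / isingProb lam G₀ x)) (sum_isingProb lam G)]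
  simp [klDiv]

open Classical in
lemma errorProb_nonneg {p n : ℕ} (lam : ℝ) (q : ℕ) (dec : Decoder p n)
    (G : SimpleGraph (Fin p)) : 0 ≤ errorProb lam q dec G := by
  unfold errorProb
  refine Finset.sum_nonneg fun X _ => mul_nonneg (sampleProb_pos _ _ _).le
    (Finset.sum_nonneg fun G' _ => ?_)
  split_ifs
  · exact ENNReal.toReal_nonneg
  · exact le_rfl

lemma errorProb_le_maxErrorProb {p n k d : ℕ} (lam : ℝ) (q : ℕ) (dec : Decoder p n)
    {G : SimpleGraph (Fin p)} (hG : G ∈ graphClass p k d) :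
    errorProb lam q dec G ≤ maxErrorProb k d lam q dec :=
  le_ciSup (f := fun G : graphClass p k d => errorProb lam q dec (G : SimpleGraph (Fin p)))
    (Set.finite_range _).bddAbove ⟨G, hG⟩

open Classical in
/-- **Fano's inequality with approximate recovery.** If the decoder must identify a graph of the
family `g` up to edit distance `q`, and every ball of radius `q` contains at most a fraction
`exp (-L)` of the family, then `n` samples must carry about `(1 - δ) L` nats of information. -/
theorem fano_approx {p n : ℕ} {ι : Type*} (I : Finset ι) (hI : I.Nonempty)
    (g : ι → SimpleGraph (Fin p)) (G₀ : SimpleGraph (Fin p)) (lam : ℝ) (q : ℕ)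
    (dec : Decoder p n) {δ L κ : ℝ} (hL : 0 ≤ L)
    (hball : ∀ G', (#{i ∈ I | editDist (g i) G' ≤ q} : ℝ) * Real.exp L ≤ #I)
    (hκ : ∀ i ∈ I, klDiv lam (g i) G₀ ≤ κ)
    (herr : ∀ i ∈ I, errorProb lam q dec (g i) ≤ δ) :
    L * (1 - δ) - Real.log 2 ≤ n * κ := by
  set D : (Fin n → Config p) → SimpleGraph (Fin p) → ℝ := fun X G' => (dec X G').toReal with hDdef
  have hD : ∀ X G', 0 ≤ D X G' := fun _ _ => ENNReal.toReal_nonneg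
  have hD1 : ∀ X, ∑ G', D X G' = 1 := fun X => sum_toReal_pmf (dec X)
  set f : ι → SimpleGraph (Fin p) → ℝ := fun i G' => if editDist (g i) G' ≤ q then L else 0
    with hf
  have h1 : ∀ i ∈ I, L * (1 - δ) ≤ n * κ +
      (1 / 2) * ∑ X, sampleProb n lam G₀ X * ∑ G', D X G' * Real.exp (f i G')
        - 1 + Real.log 2 := by
    intro i hi
    have h := sum_mul_le_klDiv_add (sampleProb_pos (n := n) lam (g i))
      (sampleProb_pos (n := n) lam G₀) (sum_sampleProb lam (g i)) hD hD1 (f i)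
    rw [sum_sampleProb_log] at h
    have h2 : ∑ X, sampleProb n lam (g i) X * ∑ G', D X G' * f i G'
        = L * (1 - errorProb lam q dec (g i)) := by
      have h3 : ∀ X, ∑ G', D X G' * f i G' = L * (1 -
          ∑ G', if q < editDist (g i) G' then (dec X G').toReal else 0) := by
        intro X
        rw [← hD1 X, ← Finset.sum_sub_distrib, Finset.mul_sum]
        refine Finset.sum_congr rfl fun G' _ => ?_
        simp only [hf, hDdef]
        by_cases hq : editDist (g i) G' ≤ q
        · simp [hq, not_lt.2 hq, mul_comm]
        · simp [hq, not_le.1 hq]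
      simp only [h3]
      unfold errorProb
      have h4 : ∀ X : Fin n → Config p, ∀ a : ℝ, sampleProb n lam (g i) X * (L * (1 - a))
          = L * (sampleProb n lam (g i) X - sampleProb n lam (g i) X * a) := by
        intros; ring
      simp only [h4]
      rw [← Finset.mul_sum, Finset.sum_sub_distrib, sum_sampleProb]
    have h5 : L * (1 - δ) ≤ L * (1 - errorProb lam q dec (g i)) :=
      mul_le_mul_of_nonneg_left (by linarith [herr i hi]) hL
    have h6 : (n : ℝ) * klDiv lam (g i) G₀ ≤ n * κ :=
      mul_le_mul_of_nonneg_left (hκ i hi) (Nat.cast_nonneg n)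
    linarith
  have h2 : ∑ i ∈ I, ∑ X, sampleProb n lam G₀ X * ∑ G', D X G' * Real.exp (f i G')
      ≤ 2 * #I := by
    rw [Finset.sum_comm]
    have h3 : ∀ X, ∑ i ∈ I, sampleProb n lam G₀ X * ∑ G', D X G' * Real.exp (f i G')
        ≤ sampleProb n lam G₀ X * (2 * #I) := by
      intro X
      rw [← Finset.mul_sum]
      refine mul_le_mul_of_nonneg_left ?_ (sampleProb_pos _ _ _).le
      rw [Finset.sum_comm, ← one_mul (2 * (#I : ℝ)), ← hD1 X, Finset.sum_mul]
      refine Finset.sum_le_sum fun G' _ => ?_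
      rw [← Finset.mul_sum]
      refine mul_le_mul_of_nonneg_left ?_ (hD X G')
      have h4 : ∀ i ∈ I, Real.exp (f i G')
          ≤ 1 + if editDist (g i) G' ≤ q then Real.exp L else 0 := by
        intro i _
        simp only [hf]
        split_ifs
        · linarith
        · simp
      refine (Finset.sum_le_sum h4).trans ?_
      rw [Finset.sum_add_distrib, ← Finset.sum_filter]
      simp only [Finset.sum_const, nsmul_eq_mul, mul_one]
      linarith [hball G']
    refine (Finset.sum_le_sum fun X _ => h3 X).trans ?_
    rw [← Finset.sum_mul, sum_sampleProb, one_mul]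
  have h3 := Finset.sum_le_sum h1
  simp only [Finset.sum_add_distrib, Finset.sum_sub_distrib, Finset.sum_const, nsmul_eq_mul,
    ← Finset.mul_sum, mul_one] at h3
  have hpos : (0 : ℝ) < #I := by exact_mod_cast hI.card_pos
  nlinarith

end IsingSelection

/-! ### Hamming balls in the power set -/

namespace IsingSelection

open Finset

/-- The Chernoff bound for the size of a Hamming ball among the subsets of `W`. -/
lemma card_ball_mul_pow_le {α : Type*} [DecidableEq α] (W Y : Finset α) (hY : Y ⊆ W) (q : ℕ)
    {z : ℝ} (hz : 0 < z) (hz1 : z ≤ 1) :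
    (#{S ∈ W.powerset | #(symmDiff S Y) ≤ q} : ℝ) * z ^ q ≤ (1 + z) ^ #W := by
  calc (#{S ∈ W.powerset | #(symmDiff S Y) ≤ q} : ℝ) * z ^ q
      = ∑ S ∈ W.powerset with #(symmDiff S Y) ≤ q, z ^ q := by simp
    _ ≤ ∑ S ∈ W.powerset with #(symmDiff S Y) ≤ q, z ^ #(symmDiff S Y) :=
        Finset.sum_le_sum fun S hS =>
          pow_le_pow_of_le_one hz.le hz1 (Finset.mem_filter.1 hS).2
    _ ≤ ∑ S ∈ W.powerset, z ^ #(symmDiff S Y) :=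
        Finset.sum_le_sum_of_subset_of_nonneg (Finset.filter_subset _ _)
          fun _ _ _ => by positivity
    _ = ∑ S ∈ W.powerset, z ^ #S := by
        refine Finset.sum_nbij' (fun S => symmDiff S Y) (fun S => symmDiff S Y) ?_ ?_ ?_ ?_ ?_
        · intro S hS
          rw [Finset.mem_powerset] at hS ⊢
          exact (Finset.symmDiff_subset_union).trans (Finset.union_subset hS hY)
        · intro S hS
          rw [Finset.mem_powerset] at hS ⊢
          exact (Finset.symmDiff_subset_union).trans (Finset.union_subset hS hY)
        · intro S _; simp
        · intro S _; simp
        · intro S _; rfl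
    _ = (1 + z) ^ #W := by
        have := Finset.sum_pow_mul_eq_add_pow z 1 W
        simpa [add_comm] using this

/-- A ball of relative radius `x < 1/2` contains at most a fraction `exp (-N (log 2 - H₂(x)))` of
the `2 ^ N` subsets of `W`. The radius is measured against a number `N₀` that may exceed `N`
slightly; the loss is at most `(N₀ - N) log 2`. -/
lemma card_ball_mul_exp_le {α : Type*} [DecidableEq α] (W Y : Finset α) (hY : Y ⊆ W) (q : ℕ)
    {x N₀ D : ℝ} (hx : 0 < x) (hx2 : x < 1 / 2) (hq : (q : ℝ) ≤ x * N₀) (hD : 0 ≤ D)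
    (hN : N₀ ≤ #W + D) :
    (#{S ∈ W.powerset | #(symmDiff S Y) ≤ q} : ℝ) *
      Real.exp (#W * (Real.log 2 - Real.binEntropy x) - D * Real.log 2) ≤ 2 ^ #W := by
  have hx1 : 0 < 1 - x := by linarith
  set z : ℝ := x / (1 - x) with hz
  have hz0 : 0 < z := by positivity
  have hz1 : z ≤ 1 := by rw [hz, div_le_one hx1]; linarith
  have hball := card_ball_mul_pow_le W Y hY q hz0 hz1
  have h1z : 1 + z = (1 - x)⁻¹ := by rw [hz]; field_simp; ring
  have hlogz : Real.log z = Real.log x - Real.log (1 - x) := Real.log_div hx.ne' hx1.ne'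
  have hlogz0 : Real.log z ≤ 0 := Real.log_nonpos hz0.le hz1
  have hent : Real.binEntropy x = -(x * Real.log z) - Real.log (1 - x) := by
    rw [Real.binEntropy, hlogz, Real.log_inv, Real.log_inv]; ring
  have hlog1 : Real.log (1 - x) ≤ 0 := Real.log_nonpos hx1.le (by linarith)
  have hxl : -(x * Real.log z) ≤ Real.log 2 := by
    have := Real.binEntropy_le_log_two (p := x)
    linarith
  have hzq : z ^ q = Real.exp (q * Real.log z) := by
    rw [← Real.log_pow, Real.exp_log (by positivity)]
  have h1zN : (1 + z) ^ #W = Real.exp (-(#W * Real.log (1 - x))) := by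
    rw [h1z, inv_pow, Real.exp_neg, ← Real.log_pow, Real.exp_log (by positivity)]
  have h2N : (2 : ℝ) ^ #W = Real.exp (#W * Real.log 2) := by
    rw [← Real.log_pow, Real.exp_log (by positivity)]
  rw [hzq, h1zN] at hball
  have hexp : #W * (Real.log 2 - Real.binEntropy x) - D * Real.log 2
      ≤ q * Real.log z + #W * Real.log (1 - x) + #W * Real.log 2 := by
    have h1 : x * N₀ * Real.log z ≤ q * Real.log z :=
      mul_le_mul_of_nonpos_right hq hlogz0
    have h2 : (N₀ - #W) * -(x * Real.log z) ≤ D * -(x * Real.log z) :=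
      mul_le_mul_of_nonneg_right (by linarith) (by nlinarith)
    have h3 : D * -(x * Real.log z) ≤ D * Real.log 2 := mul_le_mul_of_nonneg_left hxl hD
    rw [hent]
    nlinarith
  calc _ ≤ (#{S ∈ W.powerset | #(symmDiff S Y) ≤ q} : ℝ) *
        Real.exp (q * Real.log z + #W * Real.log (1 - x) + #W * Real.log 2) := by gcongr
    _ = (#{S ∈ W.powerset | #(symmDiff S Y) ≤ q} : ℝ) * Real.exp (q * Real.log z) *
        (Real.exp (#W * Real.log (1 - x)) * Real.exp (#W * Real.log 2)) := by
        rw [Real.exp_add, Real.exp_add]; ring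
    _ ≤ Real.exp (-(#W * Real.log (1 - x))) *
        (Real.exp (#W * Real.log (1 - x)) * Real.exp (#W * Real.log 2)) := by gcongr
    _ = 2 ^ #W := by
        rw [← mul_assoc, ← Real.exp_add, h2N]; simp

/-! ### Ensembles with prescribed and optional edges -/

/-- The edges of the graph spanned by a set of non-loops. -/
lemma edgeSet_fromEdgeSet_coe {V : Type*} {T : Finset (Sym2 V)} (hT : ∀ e ∈ T, ¬ e.IsDiag) :
    (SimpleGraph.fromEdgeSet (T : Set (Sym2 V))).edgeSet = T := by
  rw [SimpleGraph.edgeSet_fromEdgeSet]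
  ext e
  simp only [Set.mem_sdiff, Finset.mem_coe]
  exact ⟨fun h => h.1, fun h => ⟨h, hT e h⟩⟩

/-- Membership in the graph class passes to subgraphs. -/
lemma graphClass_mono {p k d : ℕ} {G H : SimpleGraph (Fin p)} (hGH : G ≤ H)
    (hH : H ∈ graphClass p k d) : G ∈ graphClass p k d := by
  refine ⟨(Set.ncard_le_ncard (SimpleGraph.edgeSet_subset_edgeSet.2 hGH)
    (Set.toFinite _)).trans hH.1, fun v => ?_⟩
  exact (Set.ncard_le_ncard (fun w hw => hGH hw) (Set.toFinite _)).trans (hH.2 v)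

open Classical in
/-- Fano's inequality for the ensemble of all graphs that contain the edges `F`, may contain the
edges `W`, and contain no others. -/
theorem fano_ensemble {p n k d : ℕ} (F W : Finset (Sym2 (Fin p)))
    (hdiag : ∀ e ∈ F ∪ W, ¬ e.IsDiag) (hFW : Disjoint F W)
    (hclass : SimpleGraph.fromEdgeSet ((F ∪ W : Finset _) : Set (Sym2 (Fin p)))
      ∈ graphClass p k d)
    (lam : ℝ) (q : ℕ) (dec : Decoder p n) {δ κ x N₀ D : ℝ}
    (hx : 0 < x) (hx2 : x < 1 / 2) (hq : (q : ℝ) ≤ x * N₀) (hD : 0 ≤ D)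
    (hN : N₀ ≤ #W + D)
    (hκ : ∀ S ⊆ W, klDiv lam
      (SimpleGraph.fromEdgeSet ((F ∪ S : Finset _) : Set (Sym2 (Fin p))))
      (SimpleGraph.fromEdgeSet (F : Set (Sym2 (Fin p)))) ≤ κ)
    (herr : maxErrorProb k d lam q dec ≤ δ) :
    #W * (Real.log 2 - Real.binEntropy x) * (1 - δ) - (D + 1) * Real.log 2 ≤ n * κ := by
  have hmem : ∀ S ⊆ W, SimpleGraph.fromEdgeSet ((F ∪ S : Finset _) : Set (Sym2 (Fin p)))
      ∈ graphClass p k d := by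
    intro S hS
    refine graphClass_mono (SimpleGraph.fromEdgeSet_mono ?_) hclass
    exact_mod_cast Finset.union_subset_union_right hS
  have herr' : ∀ S ∈ W.powerset, errorProb lam q dec
      (SimpleGraph.fromEdgeSet ((F ∪ S : Finset _) : Set (Sym2 (Fin p)))) ≤ δ := fun S hS =>
    (errorProb_le_maxErrorProb lam q dec (hmem S (Finset.mem_powerset.1 hS))).trans herr
  have hδ : 0 ≤ δ := (errorProb_nonneg _ _ _ _).trans (herr' ∅ (Finset.empty_mem_powerset W))
  have hlog2 : 0 < Real.log 2 := Real.log_pos (by norm_num)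
  have hκ0 : (0 : ℝ) ≤ n * κ + Real.log 2 := by
    -- the trivial case `L = 0` of Fano's inequality
    have := fano_approx W.powerset ⟨∅, Finset.empty_mem_powerset W⟩
      (fun S => SimpleGraph.fromEdgeSet ((F ∪ S : Finset _) : Set (Sym2 (Fin p))))
      (SimpleGraph.fromEdgeSet (F : Set (Sym2 (Fin p)))) lam q dec (le_refl (0 : ℝ))
      (fun G' => by
        rw [Real.exp_zero, mul_one]; exact_mod_cast Finset.card_filter_le _ _)
      (fun S hS => hκ S (Finset.mem_powerset.1 hS)) herr'
    linarith
  set c : ℝ := Real.log 2 - Real.binEntropy x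
  have hc : 0 ≤ c := sub_nonneg.2 Real.binEntropy_le_log_two
  rcases lt_or_ge (#W * c - D * Real.log 2) 0 with hneg | hL
  · have h1 : (#W : ℝ) * c * (1 - δ) ≤ #W * c := by
      have : (0 : ℝ) ≤ #W * c := by positivity
      nlinarith
    linarith
  · have h := fano_approx W.powerset ⟨∅, Finset.empty_mem_powerset W⟩
      (fun S => SimpleGraph.fromEdgeSet ((F ∪ S : Finset _) : Set (Sym2 (Fin p))))
      (SimpleGraph.fromEdgeSet (F : Set (Sym2 (Fin p)))) lam q dec hL
      (fun G' => by
        have hb := card_ball_mul_exp_le W (G'.edgeSet.toFinset ∩ W)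
          Finset.inter_subset_right q hx hx2 hq hD hN
        rw [Finset.card_powerset]
        push_cast
        refine le_trans (mul_le_mul_of_nonneg_right ?_ (Real.exp_pos _).le) hb
        norm_cast
        refine Finset.card_le_card fun S hS => ?_
        rw [Finset.mem_filter, Finset.mem_powerset] at hS ⊢
        refine ⟨hS.1, le_trans ?_ hS.2⟩
        rw [editDist, edgeSet_fromEdgeSet_coe
          fun e he => hdiag e (Finset.union_subset_union_right hS.1 he),
          ← Set.ncard_coe_finset]
        refine Set.ncard_le_ncard ?_ (Set.toFinite _)
        intro e he
        have hFe : e ∈ F → e ∉ W := fun h1 h2 => Finset.disjoint_left.1 hFW h1 h2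
        have hSe : e ∈ S → e ∈ W := fun h => hS.1 h
        simp only [Finset.coe_symmDiff, Finset.coe_inter,
          Set.mem_symmDiff, Set.mem_inter_iff, Finset.mem_coe, Set.coe_toFinset,
          Finset.coe_union, Set.mem_union] at he ⊢
        tauto)
      (fun S hS => hκ S (Finset.mem_powerset.1 hS)) herr'
    have h2 : D * Real.log 2 * (1 - δ) ≤ D * Real.log 2 := by
      have : 0 ≤ D * Real.log 2 := by positivity
      nlinarith
    linarith

end IsingSelection

/-! ### Energies, correlations and divergence -/

namespace IsingSelection

open Finset

lemma spin_mul_self {p : ℕ} (x : Config p) (i : Fin p) : spin x i * spin x i = 1 := by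
  rcases Int.units_eq_one_or (x i) with h | h <;> simp [spin, h]

lemma spin_eq_one_or {p : ℕ} (x : Config p) (i : Fin p) : spin x i = 1 ∨ spin x i = -1 := by
  rcases Int.units_eq_one_or (x i) with h | h <;> simp [spin, h]

/-- The product of the two spins at the ends of an edge. -/
def edgeSpin {p : ℕ} (x : Config p) : Sym2 (Fin p) → ℝ :=
  Sym2.lift ⟨fun i j => spin x i * spin x j, fun _ _ => mul_comm _ _⟩

@[simp] lemma edgeSpin_mk {p : ℕ} (x : Config p) (i j : Fin p) :
    edgeSpin x s(i, j) = spin x i * spin x j := rfl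

lemma edgeSpin_le_one {p : ℕ} (x : Config p) (e : Sym2 (Fin p)) : edgeSpin x e ≤ 1 := by
  induction e with
  | _ i j =>
    rcases spin_eq_one_or x i with h | h <;> rcases spin_eq_one_or x j with h' | h' <;>
      norm_num [h, h']

lemma neg_one_le_edgeSpin {p : ℕ} (x : Config p) (e : Sym2 (Fin p)) : -1 ≤ edgeSpin x e := by
  induction e with
  | _ i j =>
    rcases spin_eq_one_or x i with h | h <;> rcases spin_eq_one_or x j with h' | h' <;>
      norm_num [h, h']

lemma coupling_comm {p : ℕ} (lam : ℝ) (G : SimpleGraph (Fin p)) (i j : Fin p) :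
    coupling lam G i j = coupling lam G j i := by
  unfold coupling
  rw [G.adj_comm]

lemma coupling_self {p : ℕ} (lam : ℝ) (G : SimpleGraph (Fin p)) (i : Fin p) :
    coupling lam G i i = 0 := by
  simp [coupling]

lemma exponent_eq_sum_edges {p : ℕ} (lam : ℝ) {T : Finset (Sym2 (Fin p))}
    (hT : ∀ e ∈ T, ¬ e.IsDiag) (x : Config p) :
    exponent lam (SimpleGraph.fromEdgeSet (T : Set (Sym2 (Fin p)))) x
      = lam * ∑ e ∈ T, edgeSpin x e := by
  classical
  have h1 := Finset.sum_sym2_filter_not_isDiag (Finset.univ : Finset (Fin p))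
    (fun e => if e ∈ T then lam * edgeSpin x e else 0)
  have h2 : exponent lam (SimpleGraph.fromEdgeSet (T : Set (Sym2 (Fin p)))) x
      = ∑ i ∈ (Finset.univ : Finset (Fin p)).offDiag with i.1 < i.2,
          (if s(i.1, i.2) ∈ T then lam * edgeSpin x s(i.1, i.2) else 0) := by
    unfold exponent
    rw [Finset.sum_sigma']
    refine Finset.sum_nbij' (fun a => (a.1, a.2)) (fun b => ⟨b.1, b.2⟩) ?_ ?_ ?_ ?_ ?_
    · rintro ⟨i, j⟩ h
      simp at h
      simp [h, h.ne]
    · rintro ⟨i, j⟩ h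
      simp at h
      simp [h.2]
    · simp
    · simp
    · rintro ⟨i, j⟩ h
      have hij : i ≠ j := by
        simp at h; exact h.ne
      simp only [coupling, SimpleGraph.fromEdgeSet_adj, Finset.mem_coe, edgeSpin_mk]
      by_cases hm : s(i, j) ∈ T
      · simp [hm, hij, mul_assoc]
      · simp [hm]
  rw [h2, ← h1, Finset.mul_sum, ← Finset.sum_filter]
  refine Finset.sum_congr ?_ fun _ _ => rfl
  ext e
  simp only [Finset.mem_filter, Finset.mem_sym2_iff, Finset.mem_univ, implies_true, true_and]
  exact ⟨fun h => h.2, fun h => ⟨hT e h, h⟩⟩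

lemma exponent_eq_half_sum {p : ℕ} (lam : ℝ) (G : SimpleGraph (Fin p)) (x : Config p) :
    exponent lam G x = (1 / 2) * ∑ i, ∑ j, coupling lam G i j * spin x i * spin x j := by
  set f : Fin p → Fin p → ℝ := fun i j => coupling lam G i j * spin x i * spin x j with hf
  have hsymm : ∀ i j, f i j = f j i := fun i j => by
    simp only [hf]; rw [coupling_comm]; ring
  have h0 : ∀ i, f i i = 0 := fun i => by simp [hf, coupling_self]
  have hsplit : ∀ i, ∑ j, f i j = ∑ j ∈ Finset.Ioi i, f i j + ∑ j ∈ Finset.Iio i, f i j := by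
    intro i
    rw [← Finset.sum_union (Finset.disjoint_left.2 fun j h1 h2 => by
      simp at h1 h2; exact lt_asymm h1 h2)]
    refine (Finset.sum_subset (Finset.subset_univ _) fun j _ hj => ?_).symm
    have : j = i := by
      simp only [Finset.mem_union, Finset.mem_Ioi, Finset.mem_Iio, not_or, not_lt] at hj
      exact le_antisymm hj.1 hj.2
    rw [this, h0]
  have hswap : ∑ i, ∑ j ∈ Finset.Iio i, f i j = ∑ i, ∑ j ∈ Finset.Ioi i, f i j := by
    rw [Finset.sum_comm' (s := univ) (t := fun i => Finset.Iio i) (t' := univ)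
      (s' := fun j => Finset.Ioi j) (by simp)]
    exact Finset.sum_congr rfl fun i _ => Finset.sum_congr rfl fun j _ => hsymm _ _
  have : ∑ i, ∑ j, f i j = 2 * exponent lam G x := by
    simp only [hsplit, Finset.sum_add_distrib, hswap]
    simp only [exponent, hf]; ring
  linarith

/-- The correlation `𝔼_G[x_i x_j]` of the two ends of an edge. -/
noncomputable def corr {p : ℕ} (lam : ℝ) (G : SimpleGraph (Fin p)) (e : Sym2 (Fin p)) : ℝ :=
  ∑ x, isingProb lam G x * edgeSpin x e

lemma corr_le_one {p : ℕ} (lam : ℝ) (G : SimpleGraph (Fin p)) (e : Sym2 (Fin p)) :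
    corr lam G e ≤ 1 := by
  rw [← sum_isingProb lam G]
  exact Finset.sum_le_sum fun x _ =>
    mul_le_of_le_one_right (isingProb_pos _ _ _).le (edgeSpin_le_one _ _)

lemma neg_one_le_corr {p : ℕ} (lam : ℝ) (G : SimpleGraph (Fin p)) (e : Sym2 (Fin p)) :
    -1 ≤ corr lam G e := by
  rw [← sum_isingProb lam G, ← Finset.sum_neg_distrib]
  refine Finset.sum_le_sum fun x _ => ?_
  nlinarith [isingProb_pos lam G x, neg_one_le_edgeSpin x e]

lemma klDiv_nonneg {p : ℕ} (lam : ℝ) (G G₀ : SimpleGraph (Fin p)) : 0 ≤ klDiv lam G G₀ := by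
  have h : ∀ x, isingProb lam G x - isingProb lam G₀ x
      ≤ isingProb lam G x * Real.log (isingProb lam G x / isingProb lam G₀ x) := by
    intro x
    have hP := isingProb_pos lam G x
    have hQ := isingProb_pos lam G₀ x
    have h1 := Real.one_sub_inv_le_log_of_pos (div_pos hP hQ)
    have h2 := mul_le_mul_of_nonneg_left h1 hP.le
    rw [inv_div, mul_sub, mul_div_cancel₀ _ hP.ne', mul_one] at h2
    exact h2
  have := Finset.sum_le_sum fun x (_ : x ∈ univ) => h x
  rw [Finset.sum_sub_distrib, sum_isingProb, sum_isingProb, sub_self] at this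
  exact this

/-- The symmetrized divergence of two Ising models involves no partition function. -/
lemma klDiv_add_klDiv {p : ℕ} (lam : ℝ) (G G₀ : SimpleGraph (Fin p)) :
    klDiv lam G G₀ + klDiv lam G₀ G
      = ∑ x, (isingProb lam G x - isingProb lam G₀ x) *
          (exponent lam G x - exponent lam G₀ x) := by
  have hlog : ∀ (A B : SimpleGraph (Fin p)) (x : Config p),
      Real.log (isingProb lam A x / isingProb lam B x)
        = exponent lam A x - exponent lam B x
          + (Real.log (partitionFunction lam B) - Real.log (partitionFunction lam A)) := by
    intro A B x
    have hA := (partitionFunction_pos lam A).ne'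
    have hB := (partitionFunction_pos lam B).ne'
    rw [Real.log_div (isingProb_pos _ _ _).ne' (isingProb_pos _ _ _).ne', isingProb, isingProb,
      Real.log_div (Real.exp_pos _).ne' hA, Real.log_div (Real.exp_pos _).ne' hB,
      Real.log_exp, Real.log_exp]
    ring
  set c := Real.log (partitionFunction lam G₀) - Real.log (partitionFunction lam G) with hc
  have h : ∀ x, isingProb lam G x * Real.log (isingProb lam G x / isingProb lam G₀ x)
      + isingProb lam G₀ x * Real.log (isingProb lam G₀ x / isingProb lam G x)
      = (isingProb lam G x - isingProb lam G₀ x) * (exponent lam G x - exponent lam G₀ x)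
        + (isingProb lam G x * c - isingProb lam G₀ x * c) := by
    intro x
    rw [hlog, hlog]
    ring
  unfold klDiv
  rw [← Finset.sum_add_distrib]
  simp only [h]
  rw [Finset.sum_add_distrib, Finset.sum_sub_distrib, ← Finset.sum_mul, ← Finset.sum_mul,
    sum_isingProb, sum_isingProb]
  ring

/-- Adding edges changes an Ising model, in divergence, by at most the increase of the
correlations along the new edges. -/
lemma klDiv_le_sum_corr {p : ℕ} [DecidableEq (Sym2 (Fin p))] (lam : ℝ)
    {F S : Finset (Sym2 (Fin p))} (hdiag : ∀ e ∈ F ∪ S, ¬ e.IsDiag) (hFS : Disjoint F S) :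
    klDiv lam (SimpleGraph.fromEdgeSet ((F ∪ S : Finset _) : Set (Sym2 (Fin p))))
      (SimpleGraph.fromEdgeSet (F : Set (Sym2 (Fin p)))) ≤
    lam * ∑ e ∈ S,
      (corr lam (SimpleGraph.fromEdgeSet ((F ∪ S : Finset _) : Set (Sym2 (Fin p)))) e
        - corr lam (SimpleGraph.fromEdgeSet (F : Set (Sym2 (Fin p)))) e) := by
  have h := klDiv_add_klDiv lam
    (SimpleGraph.fromEdgeSet ((F ∪ S : Finset _) : Set (Sym2 (Fin p))))
    (SimpleGraph.fromEdgeSet (F : Set (Sym2 (Fin p))))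
  have hexp : ∀ x, exponent lam
        (SimpleGraph.fromEdgeSet ((F ∪ S : Finset _) : Set (Sym2 (Fin p)))) x
      - exponent lam (SimpleGraph.fromEdgeSet (F : Set (Sym2 (Fin p)))) x
      = lam * ∑ e ∈ S, edgeSpin x e := by
    intro x
    rw [exponent_eq_sum_edges lam hdiag,
      exponent_eq_sum_edges lam fun e he => hdiag e (Finset.mem_union_left _ he),
      Finset.sum_union hFS]
    ring
  refine (le_add_of_nonneg_right (klDiv_nonneg _ _ _)).trans (h.trans_le (le_of_eq ?_))
  simp only [hexp, corr, ← Finset.sum_sub_distrib, ← sub_mul]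
  rw [Finset.sum_comm, Finset.mul_sum]
  refine Finset.sum_congr rfl fun x _ => ?_
  rw [← Finset.mul_sum]
  ring

/-! ### Flipping single spins -/

/-- The configuration with the spin at `i` flipped. -/
def flip {p : ℕ} (i : Fin p) (x : Config p) : Config p := Function.update x i (-x i)

lemma flip_flip {p : ℕ} (i : Fin p) (x : Config p) : flip i (flip i x) = x := by
  simp [flip]

/-- Flipping a spin, as a permutation of the configurations. -/
def flipEquiv {p : ℕ} (i : Fin p) : Config p ≃ Config p :=
  ⟨flip i, flip i, flip_flip i, flip_flip i⟩

lemma sum_flip {p : ℕ} (i : Fin p) (f : Config p → ℝ) : ∑ x, f (flip i x) = ∑ x, f x :=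
  Equiv.sum_comp (flipEquiv i) f

lemma spin_flip {p : ℕ} (i u : Fin p) (x : Config p) :
    spin (flip i x) u = spin x u - if u = i then 2 * spin x i else 0 := by
  by_cases h : u = i
  · subst h; simp [spin, flip]; ring
  · simp [spin, flip, h]

/-- The magnetic field on vertex `i` created by the other spins. -/
noncomputable def field {p : ℕ} (lam : ℝ) (G : SimpleGraph (Fin p)) (i : Fin p)
    (x : Config p) : ℝ :=
  ∑ u, coupling lam G i u * spin x u

lemma exponent_flip {p : ℕ} (lam : ℝ) (G : SimpleGraph (Fin p)) (i : Fin p) (x : Config p) :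
    exponent lam G (flip i x) = exponent lam G x - 2 * spin x i * field lam G i x := by
  rw [exponent_eq_half_sum, exponent_eq_half_sum]
  have h : ∀ u v, coupling lam G u v * spin (flip i x) u * spin (flip i x) v
      = coupling lam G u v * spin x u * spin x v
        - (if v = i then 2 * spin x i * (coupling lam G u v * spin x u) else 0)
        - (if u = i then 2 * spin x i * (coupling lam G u v * spin x v) else 0)
        + (if u = i then if v = i then coupling lam G u v * (2 * spin x i) * (2 * spin x i)
            else 0 else 0) := by
    intro u v
    rw [spin_flip, spin_flip]
    split_ifs <;> ring
  simp only [h, Finset.sum_add_distrib, Finset.sum_sub_distrib]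
  have e1 : ∑ u, ∑ v, (if v = i then 2 * spin x i * (coupling lam G u v * spin x u) else 0)
      = 2 * spin x i * field lam G i x := by
    simp only [Finset.sum_ite_eq', Finset.mem_univ, if_true, field, Finset.mul_sum]
    exact Finset.sum_congr rfl fun u _ => by rw [coupling_comm]
  have e2 : ∑ u, ∑ v, (if u = i then 2 * spin x i * (coupling lam G u v * spin x v) else 0)
      = 2 * spin x i * field lam G i x := by
    rw [Finset.sum_comm]
    simp only [Finset.sum_ite_eq', Finset.mem_univ, if_true, field, Finset.mul_sum]
  have e3 : ∑ u, ∑ v, (if u = i then if v = i then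
      coupling lam G u v * (2 * spin x i) * (2 * spin x i) else 0 else 0) = 0 := by
    refine Finset.sum_eq_zero fun u _ => Finset.sum_eq_zero fun v _ => ?_
    split_ifs with h1 h2
    · rw [h1, h2, coupling_self]; ring
    · rfl
    · rfl
  rw [e1, e2, e3]
  ring

lemma field_flip {p : ℕ} (lam : ℝ) (G : SimpleGraph (Fin p)) (i j : Fin p) (x : Config p) :
    field lam G i (flip j x) = field lam G i x - 2 * coupling lam G i j * spin x j := by
  have h : ∀ u, coupling lam G i u * spin (flip j x) u = coupling lam G i u * spin x u
      - if u = j then coupling lam G i u * (2 * spin x j) else 0 := by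
    intro u
    rw [spin_flip]
    split_ifs with h
    · ring
    · ring
  simp only [field, h, Finset.sum_sub_distrib, Finset.sum_ite_eq', Finset.mem_univ, if_true]
  ring

/-- Without interaction, distinct spins are uncorrelated. -/
lemma corr_bot {p : ℕ} (lam : ℝ) {e : Sym2 (Fin p)} (he : ¬ e.IsDiag) :
    corr lam (⊥ : SimpleGraph (Fin p)) e = 0 := by
  induction e with
  | _ i j =>
    have hij : j ≠ i := fun h => he (by simp [h])
    have hprob : ∀ x, isingProb lam (⊥ : SimpleGraph (Fin p)) (flip i x)
        = isingProb lam (⊥ : SimpleGraph (Fin p)) x := by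
      intro x
      simp [isingProb, exponent, coupling]
    have h := sum_flip i fun x => isingProb lam (⊥ : SimpleGraph (Fin p)) x * edgeSpin x s(i, j)
    have h2 : ∀ x : Config p, edgeSpin (flip i x) s(i, j) = - edgeSpin x s(i, j) := by
      intro x
      rw [edgeSpin_mk, edgeSpin_mk, spin_flip, spin_flip, if_pos rfl, if_neg hij]
      ring
    simp only [hprob, h2, mul_neg, Finset.sum_neg_distrib] at h
    unfold corr
    linarith

open Classical in
/-- Conditionally on the other spins, `x_i` and `x_j` form a two-spin model in external fields
`a` and `b`; with fields of size at most `lam * m` each, the two spins are the most correlated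
when `a = b = lam * m`. -/
lemma corr_le {p : ℕ} {lam : ℝ} (hlam : 0 < lam) (G : SimpleGraph (Fin p)) {m : ℕ}
    (hdeg : ∀ v, (G.neighborSet v).ncard ≤ m) {e : Sym2 (Fin p)} (he : e ∈ G.edgeSet) :
    corr lam G e ≤ (Real.exp (2 * lam) * Real.cosh (2 * lam * m) - 1) /
      (Real.exp (2 * lam) * Real.cosh (2 * lam * m) + 1) := by
  induction e with
  | _ i j =>
    rw [SimpleGraph.mem_edgeSet] at he
    set K := Real.exp (2 * lam) * Real.cosh (2 * lam * m) with hK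
    have hK0 : 0 < K := mul_pos (Real.exp_pos _) (Real.cosh_pos _)
    have hij : i ≠ j := he.ne
    have hcij : coupling lam G i j = lam := by simp [coupling, he]
    -- the field on `u`, without the contribution of its neighbour `v`
    have hfield : ∀ u v : Fin p, G.Adj u v → ∀ x : Config p,
        |field lam G u x - lam * spin x v| ≤ lam * m := by
      intro u v huv x
      have h1 : field lam G u x = ∑ w ∈ G.neighborFinset u, lam * spin x w := by
        rw [field, SimpleGraph.neighborFinset_eq_filter, Finset.sum_filter]
        exact Finset.sum_congr rfl fun w _ => by simp [coupling]
      have hv : v ∈ G.neighborFinset u := by simpa using huv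
      rw [h1, ← Finset.sum_erase_eq_sub hv]
      refine (Finset.abs_sum_le_sum_abs _ _).trans ?_
      have habs : ∀ w, |lam * spin x w| = lam := by
        intro w
        rcases spin_eq_one_or x w with h | h <;> simp [h, abs_of_pos hlam]
      simp only [habs, Finset.sum_const, nsmul_eq_mul]
      rw [mul_comm]
      refine mul_le_mul_of_nonneg_left ?_ hlam.le
      have h2 := hdeg u
      rw [← SimpleGraph.coe_neighborFinset, Set.ncard_coe_finset] at h2
      exact_mod_cast (Finset.card_le_card (Finset.erase_subset _ _)).trans h2
    set w : Config p → ℝ := fun x => Real.exp (exponent lam G x) with hw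
    set f : Config p → ℝ := fun x => w x * ((K + 1) * edgeSpin x s(i, j) - (K - 1)) with hf
    have hsum4 : ∑ x, (f x + f (flip i x) + f (flip j x) + f (flip i (flip j x)))
        = 4 * ∑ x, f x := by
      have h3 : ∑ x, f (flip i (flip j x)) = ∑ x, f x := by
        rw [sum_flip j fun x => f (flip i x), sum_flip]
      rw [Finset.sum_add_distrib, Finset.sum_add_distrib, Finset.sum_add_distrib, sum_flip,
        sum_flip, h3]
      ring
    have hnonpos : ∀ x, f x + f (flip i x) + f (flip j x) + f (flip i (flip j x)) ≤ 0 := by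
      intro x
      obtain ⟨a, ha⟩ : ∃ a, a = field lam G i x - lam * spin x j := ⟨_, rfl⟩
      obtain ⟨b, hb⟩ : ∃ b, b = field lam G j x - lam * spin x i := ⟨_, rfl⟩
      have ha' : |a| ≤ lam * m := by rw [ha]; exact hfield i j he x
      have hb' : |b| ≤ lam * m := by rw [hb]; exact hfield j i he.symm x
      have e1 : exponent lam G (flip i x)
          = exponent lam G x - 2 * a * spin x i - 2 * lam * (spin x i * spin x j) := by
        rw [exponent_flip, ha]; ring
      have e2 : exponent lam G (flip j x)
          = exponent lam G x - 2 * b * spin x j - 2 * lam * (spin x i * spin x j) := by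
        rw [exponent_flip, hb]; ring
      have e3 : exponent lam G (flip i (flip j x))
          = exponent lam G x - 2 * a * spin x i - 2 * b * spin x j := by
        rw [exponent_flip, e2, field_flip, hcij, spin_flip, if_neg hij, ha]
        ring
      have g0 : edgeSpin x s(i, j) = spin x i * spin x j := rfl
      have g1 : edgeSpin (flip i x) s(i, j) = -(spin x i * spin x j) := by
        rw [edgeSpin_mk, spin_flip, spin_flip, if_pos rfl, if_neg hij.symm]; ring
      have g2 : edgeSpin (flip j x) s(i, j) = -(spin x i * spin x j) := by
        rw [edgeSpin_mk, spin_flip, spin_flip, if_pos rfl, if_neg hij]; ring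
      have g3 : edgeSpin (flip i (flip j x)) s(i, j) = spin x i * spin x j := by
        rw [edgeSpin_mk, spin_flip, spin_flip, spin_flip, spin_flip, if_pos rfl, if_neg hij,
          if_neg hij.symm, if_pos rfl]; ring
      have hcosh : Real.cosh (a + b) ≤ Real.cosh (2 * lam * m) := by
        rw [Real.cosh_le_cosh]
        refine (abs_add_le a b).trans ?_
        rw [abs_of_nonneg (a := 2 * lam * m) (by positivity)]
        linarith
      have hcosh1 : 1 ≤ Real.cosh (a - b) := Real.one_le_cosh _
      have hmain : Real.exp (2 * lam) * Real.cosh (a + b) ≤ K * Real.cosh (a - b) := by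
        rw [hK]
        have := mul_le_mul_of_nonneg_left hcosh (Real.exp_pos (2 * lam)).le
        nlinarith
      -- the four weights, up to the common factor `exp E`
      obtain ⟨E, hE⟩ : ∃ E, E = exponent lam G x - a * spin x i - b * spin x j
        - lam * (spin x i * spin x j) := ⟨_, rfl⟩
      have hx : exponent lam G x = E + a * spin x i + b * spin x j
        + lam * (spin x i * spin x j) := by rw [hE]; ring
      have key : Real.exp E * (Real.exp (-lam)) * (4 * (Real.exp (2 * lam) * Real.cosh (a + b)
          - K * Real.cosh (a - b))) ≤ 0 := by
        refine mul_nonpos_of_nonneg_of_nonpos (by positivity) (by linarith)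
      have hexp2 : Real.exp lam = Real.exp (-lam) * Real.exp (2 * lam) := by
        rw [← Real.exp_add]; congr 1; ring
      refine le_of_eq_of_le ?_ key
      simp only [hf, hw, e1, e2, e3, g0, g1, g2, g3, hx]
      rw [Real.cosh_eq, Real.cosh_eq]
      have t1 : Real.exp (a + b) = Real.exp a * Real.exp b := Real.exp_add _ _
      have t2 : Real.exp (-(a + b)) = Real.exp (-a) * Real.exp (-b) := by
        rw [← Real.exp_add]; congr 1; ring
      have t3 : Real.exp (a - b) = Real.exp a * Real.exp (-b) := by
        rw [← Real.exp_add]; congr 1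
      have t4 : Real.exp (-(a - b)) = Real.exp (-a) * Real.exp b := by
        rw [← Real.exp_add]; congr 1; ring
      rw [t1, t2, t3, t4]
      have hcomb : ∀ s t r : ℝ, Real.exp (E + s * a + t * b + r * lam)
          = Real.exp E * Real.exp (s * a) * Real.exp (t * b) * Real.exp (r * lam) := by
        intro s t r
        rw [Real.exp_add, Real.exp_add, Real.exp_add]
      have q1 := hcomb 1 1 1
      have q2 := hcomb (-1) 1 (-1)
      have q3 := hcomb 1 (-1) (-1)
      have q4 := hcomb (-1) (-1) 1
      simp only [one_mul, neg_mul] at q1 q2 q3 q4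
      ring_nf at q1 q2 q3 q4 hexp2
      rcases spin_eq_one_or x i with hi | hi <;> rcases spin_eq_one_or x j with hj | hj <;>
      · simp only [hi, hj]
        ring_nf
        rw [q1, q2, q3, q4, hexp2]
        ring
    have hle : ∑ x, f x ≤ 0 := by
      have := Finset.sum_nonpos fun x (_ : x ∈ univ) => hnonpos x
      linarith
    rw [le_div_iff₀ (by positivity)]
    have hZ := partitionFunction_pos lam G
    have h5 : ∑ x, f x = partitionFunction lam G * ((K + 1) * corr lam G s(i, j) - (K - 1)) := by
      have h6 : ∀ x, f x = partitionFunction lam G * ((K + 1) *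
          (isingProb lam G x * edgeSpin x s(i, j)) - (K - 1) * isingProb lam G x) := by
        intro x
        simp only [hf, hw, isingProb]
        field_simp
      simp only [h6]
      rw [← Finset.mul_sum, Finset.sum_sub_distrib, ← Finset.mul_sum, ← Finset.mul_sum,
        sum_isingProb]
      simp [corr]
    rw [h5] at hle
    have := nonpos_of_mul_nonpos_right hle hZ
    linarith

end IsingSelection

/-! ### Sparse ensemble: subgraphs of a circulant graph -/

namespace IsingSelection

open Finset

/-- For `2 * h < p`, the circulant graph with offsets `1, …, h` has `p * h` edges and is
`2 * h`-regular, so it contains graphs of every size `k ≤ p * h` with degrees at most `2 * h`. -/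
lemma exists_edges_of_le {p h k : ℕ} (hp : 2 * h < p) (hk : k ≤ p * h) :
    ∃ W : Finset (Sym2 (Fin p)), #W = k ∧ (∀ e ∈ W, ¬ e.IsDiag) ∧
      ∀ v, ((SimpleGraph.fromEdgeSet (W : Set (Sym2 (Fin p)))).neighborSet v).ncard ≤ 2 * h := by
  classical
  have : NeZero p := ⟨by omega⟩
  set c : Fin h → Fin p := fun t => ⟨t + 1, by omega⟩ with hc
  have hcc : ∀ t t', c t + c t' ≠ 0 := by
    intro t t' h0
    have h1 := congrArg Fin.val h0
    rw [Fin.val_add, Fin.val_zero, Nat.mod_eq_of_lt (by simp only [hc]; omega)] at h1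
    simp [hc] at h1
  have hc0 : ∀ t, c t ≠ 0 := by
    intro t h0
    have h1 := congrArg Fin.val h0
    simp [hc] at h1
  have hcinj : Function.Injective c := by
    intro t t' h0
    have h1 := congrArg Fin.val h0
    simp only [hc] at h1
    exact Fin.ext (by omega)
  set φ : Fin p × Fin h → Sym2 (Fin p) := fun a => s(a.1, a.1 + c a.2) with hφ
  have hφinj : Function.Injective φ := by
    rintro ⟨i, t⟩ ⟨j, t'⟩ h
    simp only [hφ, Sym2.eq_iff] at h
    rcases h with ⟨h1, h2⟩ | ⟨h1, h2⟩
    · subst h1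
      rw [hcinj (add_left_cancel h2)]
    · rw [h1, add_assoc] at h2
      exact absurd (add_eq_left.1 h2) (hcc _ _)
  have hcard : #(univ.image φ) = p * h := by
    rw [Finset.card_image_of_injective _ hφinj]; simp
  obtain ⟨W, hW, hWk⟩ := Finset.exists_subset_card_eq (hk.trans_eq hcard.symm)
  have hWφ : ∀ e ∈ W, ∃ i t, e = s(i, i + c t) := by
    intro e he
    obtain ⟨a, -, ha⟩ := Finset.mem_image.1 (hW he)
    exact ⟨a.1, a.2, ha.symm⟩
  refine ⟨W, hWk, ?_, ?_⟩
  · intro e he hd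
    obtain ⟨i, t, rfl⟩ := hWφ e he
    rw [Sym2.mk_isDiag_iff] at hd
    exact hc0 t (left_eq_add.1 hd)
  · intro v
    have hsub : (SimpleGraph.fromEdgeSet (W : Set (Sym2 (Fin p)))).neighborSet v ⊆
        ((univ.image fun t => v + c t) ∪ univ.image fun t => v - c t : Finset (Fin p)) := by
      intro w hw
      rw [SimpleGraph.mem_neighborSet, SimpleGraph.fromEdgeSet_adj] at hw
      obtain ⟨i, t, hit⟩ := hWφ _ (Finset.mem_coe.1 hw.1)
      rw [Finset.mem_coe, Finset.mem_union, Finset.mem_image, Finset.mem_image]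
      rcases Sym2.eq_iff.1 hit with ⟨h1, h2⟩ | ⟨h1, h2⟩
      · exact Or.inl ⟨t, Finset.mem_univ _, by rw [h1, h2]⟩
      · exact Or.inr ⟨t, Finset.mem_univ _, by rw [h1, h2]; simp⟩
    refine (Set.ncard_le_ncard hsub (Set.toFinite _)).trans ?_
    rw [Set.ncard_coe_finset]
    refine (Finset.card_union_le _ _).trans ?_
    have h1 : #(univ.image fun t => v + c t) ≤ h := by
      simpa using Finset.card_image_le (s := (univ : Finset (Fin h))) (f := fun t => v + c t)
    have h2 : #(univ.image fun t => v - c t) ≤ h := by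
      simpa using Finset.card_image_le (s := (univ : Finset (Fin h))) (f := fun t => v - c t)
    omega

lemma floor_mul_le {θ : ℝ} (hθ : 0 < θ) (k : ℕ) : ((⌊θ * (k : ℝ)⌋₊ : ℕ) : ℝ) ≤ θ * k :=
  Nat.floor_le (by positivity)

/-- Fano's inequality for the subgraphs of a graph with `k` edges and degrees at most `d'`: each
edge contributes at most `lam` times the largest possible correlation of adjacent spins. -/
theorem fano_sparse {p n k d d' : ℕ} (hp : d' < p) (hd : d' ≤ d) (hk : k ≤ p * (d' / 2))
    {θ lam δ : ℝ} (hθ : 0 < θ) (hθ2 : θ < 1 / 2) (hlam : 0 < lam) (dec : Decoder p n)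
    (herr : maxErrorProb k d lam ⌊θ * (k : ℝ)⌋₊ dec ≤ δ) :
    k * (Real.log 2 - Real.binEntropy θ) * (1 - δ) - Real.log 2 ≤
      n * (lam * (k * ((Real.exp (2 * lam) * Real.cosh (2 * lam * d') - 1) /
        (Real.exp (2 * lam) * Real.cosh (2 * lam * d') + 1)))) := by
  classical
  obtain ⟨W, hWk, hdiag, hdeg⟩ := exists_edges_of_le (p := p) (h := d' / 2) (by omega) hk
  have hdeg' : ∀ v, ((SimpleGraph.fromEdgeSet (W : Set (Sym2 (Fin p)))).neighborSet v).ncard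
      ≤ d' := fun v => (hdeg v).trans (by omega)
  set τ := (Real.exp (2 * lam) * Real.cosh (2 * lam * d') - 1) /
        (Real.exp (2 * lam) * Real.cosh (2 * lam * d') + 1) with hτ
  have hτ0 : 0 ≤ τ := by
    have h1 : 1 ≤ Real.exp (2 * lam) := Real.one_le_exp (by positivity)
    have h2 := Real.one_le_cosh (2 * lam * d')
    exact div_nonneg (by nlinarith) (by nlinarith)
  have h := fano_ensemble (k := k) (d := d) ∅ W (by simpa using hdiag)
    (Finset.disjoint_empty_left W)
    (by
      rw [Finset.empty_union]
      refine ⟨?_, fun v => (hdeg' v).trans hd⟩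
      rw [edgeSet_fromEdgeSet_coe hdiag, Set.ncard_coe_finset, hWk])
    lam ⌊θ * (k : ℝ)⌋₊ dec (κ := lam * (k * τ)) (N₀ := k) (D := 0) hθ hθ2 (floor_mul_le hθ k)
    le_rfl (by rw [hWk]; simp) (by
      intro S hS
      have hdiagS : ∀ e ∈ S, ¬ e.IsDiag := fun e he => hdiag e (hS he)
      refine (klDiv_le_sum_corr lam (by simpa using hdiagS)
        (Finset.disjoint_empty_left S)).trans (mul_le_mul_of_nonneg_left ?_ hlam.le)
      rw [Finset.coe_empty, SimpleGraph.fromEdgeSet_empty, Finset.empty_union]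
      have hle : ∀ e ∈ S, corr lam (SimpleGraph.fromEdgeSet (S : Set (Sym2 (Fin p)))) e
          - corr lam ⊥ e ≤ τ := by
        intro e he
        rw [corr_bot lam (hdiagS e he), sub_zero]
        refine corr_le hlam _ (fun v => ?_) ?_
        · refine (Set.ncard_le_ncard ?_ (Set.toFinite _)).trans (hdeg' v)
          intro w hw
          exact SimpleGraph.fromEdgeSet_mono (Finset.coe_subset.2 hS) hw
        · rw [edgeSet_fromEdgeSet_coe hdiagS]
          exact he
      refine (Finset.sum_le_card_nsmul _ _ _ hle).trans ?_
      rw [nsmul_eq_mul]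
      refine mul_le_mul_of_nonneg_right ?_ hτ0
      rw [← hWk]
      exact_mod_cast Finset.card_le_card hS) herr
  rw [hWk] at h
  linarith

end IsingSelection

/-! ### Dense ensemble: disjoint blocks containing complete bipartite graphs -/

namespace IsingSelection

open Finset

section Blocks

variable {p B m : ℕ} (e : Fin B × Bool × Fin m ↪ Fin p)

/-- The edges between the two sides of each block: `B` disjoint copies of `K_{m,m}`. The vertex
`e (b, s, u)` is the `u`-th one on side `s` of block `b`. -/
def crossEdges : Finset (Sym2 (Fin p)) :=
  univ.image fun a : Fin B × Fin m × Fin m => s(e (a.1, false, a.2.1), e (a.1, true, a.2.2))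

/-- The edges inside the sides of the blocks; together with `crossEdges` they turn each block
into a clique on `2 * m` vertices. -/
def sideEdges : Finset (Sym2 (Fin p)) :=
  univ.image fun a : Fin B × Bool × {σ : Sym2 (Fin m) // ¬ σ.IsDiag} =>
    a.2.2.1.map fun u => e (a.1, a.2.1, u)

lemma crossEdges_injective : Function.Injective
    fun a : Fin B × Fin m × Fin m => s(e (a.1, false, a.2.1), e (a.1, true, a.2.2)) := by
  rintro ⟨b, u, v⟩ ⟨b', u', v'⟩ h
  simp at h
  simp [h]

lemma sideEdges_injective : Function.Injective
    fun a : Fin B × Bool × {σ : Sym2 (Fin m) // ¬ σ.IsDiag} =>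
      a.2.2.1.map fun u => e (a.1, a.2.1, u) := by
  rintro ⟨b, s, σ, hσ⟩ ⟨b', s', σ', hσ'⟩ h
  induction σ with
  | _ u v =>
    induction σ' with
    | _ u' v' =>
      simp at h
      simp only [Prod.mk.injEq, Subtype.mk.injEq, Sym2.eq_iff]
      tauto

lemma card_crossEdges : #(crossEdges e) = B * (m * m) := by
  rw [crossEdges, Finset.card_image_of_injective _ (crossEdges_injective e)]
  simp

lemma card_sideEdges : #(sideEdges e) = B * (m * (m - 1)) := by
  rw [sideEdges, Finset.card_image_of_injective _ (sideEdges_injective e), Finset.card_univ,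
    Fintype.card_prod, Fintype.card_prod, Sym2.card_subtype_not_diag, Fintype.card_fin,
    Fintype.card_fin, Fintype.card_bool, Nat.choose_two_right,
    Nat.mul_div_cancel' (Nat.even_mul_pred_self m).two_dvd]

lemma exists_of_mem_crossEdges {a : Sym2 (Fin p)} (h : a ∈ crossEdges e) :
    ∃ b u v, a = s(e (b, false, u), e (b, true, v)) := by
  obtain ⟨⟨b, u, v⟩, -, rfl⟩ := Finset.mem_image.1 h
  exact ⟨b, u, v, rfl⟩

lemma exists_of_mem_sideEdges {a : Sym2 (Fin p)} (h : a ∈ sideEdges e) :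
    ∃ b s u v, u ≠ v ∧ a = s(e (b, s, u), e (b, s, v)) := by
  obtain ⟨⟨b, s, σ, hσ⟩, -, rfl⟩ := Finset.mem_image.1 h
  induction σ with
  | _ u v => exact ⟨b, s, u, v, by simpa using hσ, rfl⟩

lemma disjoint_crossEdges_sideEdges : Disjoint (crossEdges e) (sideEdges e) := by
  refine Finset.disjoint_left.2 fun a h1 h2 => ?_
  obtain ⟨b, u, v, rfl⟩ := exists_of_mem_crossEdges e h1
  obtain ⟨b', s, u', v', -, h⟩ := exists_of_mem_sideEdges e h2
  simp only [Sym2.eq_iff, EmbeddingLike.apply_eq_iff_eq, Prod.mk.injEq] at h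
  rcases h with ⟨⟨-, h1, -⟩, -, h2, -⟩ | ⟨⟨-, h1, -⟩, -, h2, -⟩ <;>
    exact absurd (h1.trans h2.symm) (by decide)

lemma exists_block_of_mem {v w : Fin p} (h : s(v, w) ∈ crossEdges e ∪ sideEdges e) :
    ∃ b y y', y ≠ y' ∧ v = e (b, y) ∧ w = e (b, y') := by
  rcases Finset.mem_union.1 h with h | h
  · obtain ⟨b, u, u', h⟩ := exists_of_mem_crossEdges e h
    rcases Sym2.eq_iff.1 h with ⟨h1, h2⟩ | ⟨h1, h2⟩
    · exact ⟨b, _, _, by simp, h1, h2⟩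
    · exact ⟨b, _, _, by simp, h1, h2⟩
  · obtain ⟨b, s, u, u', hu, h⟩ := exists_of_mem_sideEdges e h
    rcases Sym2.eq_iff.1 h with ⟨h1, h2⟩ | ⟨h1, h2⟩
    · exact ⟨b, _, _, by simp [hu], h1, h2⟩
    · exact ⟨b, _, _, by simp [hu.symm], h1, h2⟩

lemma not_isDiag_of_mem_blocks : ∀ a ∈ crossEdges e ∪ sideEdges e, ¬ a.IsDiag := by
  intro a ha hd
  induction a with
  | _ v w =>
    obtain ⟨b, y, y', hy, rfl, rfl⟩ := exists_block_of_mem e ha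
    simp [hy] at hd

lemma blocks_mem_graphClass {k d : ℕ} (hk : B * (m * (2 * m - 1)) ≤ k) (hd : 2 * m - 1 ≤ d) :
    SimpleGraph.fromEdgeSet ((crossEdges e ∪ sideEdges e : Finset _) : Set (Sym2 (Fin p)))
      ∈ graphClass p k d := by
  classical
  refine ⟨?_, fun v => le_trans ?_ hd⟩
  · rw [edgeSet_fromEdgeSet_coe (not_isDiag_of_mem_blocks e), Set.ncard_coe_finset,
      Finset.card_union_of_disjoint (disjoint_crossEdges_sideEdges e), card_crossEdges,
      card_sideEdges, ← mul_add, ← mul_add]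
    convert hk using 3
    omega
  · rcases Set.eq_empty_or_nonempty ((SimpleGraph.fromEdgeSet
      ((crossEdges e ∪ sideEdges e : Finset _) : Set (Sym2 (Fin p)))).neighborSet v)
      with h | ⟨w, hw⟩
    · rw [h, Set.ncard_empty]
      exact Nat.zero_le _
    · rw [SimpleGraph.mem_neighborSet, SimpleGraph.fromEdgeSet_adj, Finset.mem_coe] at hw
      obtain ⟨b, y, y', hy, rfl, -⟩ := exists_block_of_mem e hw.1
      have hsub : (SimpleGraph.fromEdgeSet ((crossEdges e ∪ sideEdges e : Finset _) :
          Set (Sym2 (Fin p)))).neighborSet (e (b, y)) ⊆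
          ((univ.erase y).image fun z => e (b, z) : Finset (Fin p)) := by
        intro w hw
        rw [SimpleGraph.mem_neighborSet, SimpleGraph.fromEdgeSet_adj, Finset.mem_coe] at hw
        obtain ⟨b', z, z', hz, h1, rfl⟩ := exists_block_of_mem e hw.1
        have h2 := e.injective h1
        simp only [Prod.mk.injEq] at h2
        obtain ⟨rfl, rfl⟩ := h2
        exact Finset.mem_coe.2 (Finset.mem_image.2 ⟨z', by simp [hz.symm], rfl⟩)
      refine (Set.ncard_le_ncard hsub (Set.toFinite _)).trans ?_
      rw [Set.ncard_coe_finset]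
      refine Finset.card_image_le.trans ?_
      rw [Finset.card_erase_of_mem (Finset.mem_univ _)]
      simp [two_mul]

/-- The total spin of side `s` of block `b`. -/
def sideSpin (x : Config p) (b : Fin B) (s : Bool) : ℝ := ∑ u, spin x (e (b, s, u))

lemma exponent_crossEdges (lam : ℝ) (x : Config p) :
    exponent lam (SimpleGraph.fromEdgeSet (crossEdges e : Set (Sym2 (Fin p)))) x
      = lam * ∑ b, sideSpin e x b false * sideSpin e x b true := by
  rw [exponent_eq_sum_edges lam fun a ha =>
      not_isDiag_of_mem_blocks e a (Finset.mem_union_left _ ha), crossEdges,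
    Finset.sum_image fun a _ a' _ h => crossEdges_injective e h, Fintype.sum_prod_type]
  congr 1
  refine Finset.sum_congr rfl fun b _ => ?_
  rw [Fintype.sum_prod_type, sideSpin, sideSpin, Finset.sum_mul_sum]
  rfl

open Classical in
/-- The configuration with the spins at the vertices `e (b, y)`, `y ∈ T`, flipped. -/
def flipBlock (b : Fin B) (T : Finset (Bool × Fin m)) (x : Config p) : Config p :=
  fun v => if ∃ y ∈ T, v = e (b, y) then -x v else x v

lemma flipBlock_involutive (b : Fin B) (T : Finset (Bool × Fin m)) :
    Function.Involutive (flipBlock e b T) := by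
  intro x
  funext v
  by_cases h : ∃ y ∈ T, v = e (b, y) <;> simp [flipBlock, h]

lemma spin_flipBlock_same (b : Fin B) (T : Finset (Bool × Fin m)) (x : Config p)
    (y : Bool × Fin m) :
    spin (flipBlock e b T x) (e (b, y)) = if y ∈ T then -spin x (e (b, y))
      else spin x (e (b, y)) := by
  have h : (∃ z ∈ T, e (b, y) = e (b, z)) ↔ y ∈ T := by simp
  by_cases hy : y ∈ T
  · simp [spin, flipBlock, hy]
  · simp [spin, flipBlock, hy]

lemma spin_flipBlock_other {b b' : Fin B} (hb : b' ≠ b) (T : Finset (Bool × Fin m))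
    (x : Config p) (y : Bool × Fin m) :
    spin (flipBlock e b T x) (e (b', y)) = spin x (e (b', y)) := by
  have h : ¬ ∃ z ∈ T, e (b', y) = e (b, z) := by
    simp [hb]
  simp only [spin, flipBlock, if_neg h]

/-- In `K_{m,m}` a set of `t ≤ m` vertices has at least `m * t / 2` edges to its complement, so
its spins cost at least a factor `exp (-lam * m * t)` if they oppose all the others. -/
lemma exponent_le_of_flipBlock_const {lam : ℝ} (hlam : 0 < lam) (b : Fin B)
    {T : Finset (Bool × Fin m)} (hT : #T ≤ m) (x : Config p) (ε : ℤˣ)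
    (hx : ∀ y, flipBlock e b T x (e (b, y)) = ε) :
    exponent lam (SimpleGraph.fromEdgeSet (crossEdges e : Set (Sym2 (Fin p)))) x ≤
      exponent lam (SimpleGraph.fromEdgeSet (crossEdges e : Set (Sym2 (Fin p))))
        (flipBlock e b T x) - lam * m * #T := by
  rw [exponent_crossEdges, exponent_crossEdges, ← Finset.add_sum_erase _ _ (Finset.mem_univ b),
    ← Finset.add_sum_erase univ (fun b' => sideSpin e (flipBlock e b T x) b' false *
      sideSpin e (flipBlock e b T x) b' true) (Finset.mem_univ b)]
  have hrest : ∑ b' ∈ univ.erase b, sideSpin e (flipBlock e b T x) b' false *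
      sideSpin e (flipBlock e b T x) b' true
      = ∑ b' ∈ univ.erase b, sideSpin e x b' false * sideSpin e x b' true := by
    refine Finset.sum_congr rfl fun b' hb' => ?_
    simp only [sideSpin, spin_flipBlock_other e (Finset.ne_of_mem_erase hb')]
  rw [hrest]
  set a : Bool → ℝ := fun s => ∑ u, if (s, u) ∈ T then (1 : ℝ) else 0 with ha
  have hcard : a false + a true = #T := by
    have h1 : (#T : ℝ) = ∑ y, if y ∈ T then (1 : ℝ) else 0 := by simp
    rw [h1, Fintype.sum_prod_type, Fintype.sum_bool, add_comm]
  have hspin : ∀ y, spin (flipBlock e b T x) (e (b, y)) = ((ε : ℤ) : ℝ) := fun y => by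
    rw [spin, hx]
  have hflip : ∀ s, sideSpin e (flipBlock e b T x) b s = ((ε : ℤ) : ℝ) * m := by
    intro s
    simp only [sideSpin, hspin]
    simp [mul_comm]
  have horig : ∀ s, sideSpin e x b s = ((ε : ℤ) : ℝ) * (m - 2 * a s) := by
    intro s
    have h1 : ∀ u, spin x (e (b, s, u))
        = ((ε : ℤ) : ℝ) * (1 - 2 * if (s, u) ∈ T then (1 : ℝ) else 0) := by
      intro u
      have h2 := spin_flipBlock_same e b T x (s, u)
      rw [hspin] at h2
      split_ifs at h2 ⊢ <;> linarith
    simp only [sideSpin, h1]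
    rw [← Finset.mul_sum, Finset.sum_sub_distrib, ← Finset.mul_sum]
    simp [ha]
  have hε : ((ε : ℤ) : ℝ) * ((ε : ℤ) : ℝ) = 1 := by
    rcases Int.units_eq_one_or ε with h | h <;> simp [h]
  rw [hflip, hflip, horig, horig]
  have hTm : (#T : ℝ) ≤ m := by exact_mod_cast hT
  have h0 : ∀ s, 0 ≤ a s := fun s => Finset.sum_nonneg fun u _ => by split_ifs <;> norm_num
  have hcut : (m - 2 * a false) * (m - 2 * a true) ≤ (m : ℝ) * m - m * #T := by
    rw [← hcard] at hTm ⊢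
    nlinarith [sq_nonneg (a false - a true), h0 false, h0 true,
      mul_le_mul_of_nonneg_right hTm (add_nonneg (h0 false) (h0 true))]
  have e1 : ((ε : ℤ) : ℝ) * (m - 2 * a false) * (((ε : ℤ) : ℝ) * (m - 2 * a true))
      = (m - 2 * a false) * (m - 2 * a true) := by
    linear_combination (m - 2 * a false) * (m - 2 * a true) * hε
  have e2 : ((ε : ℤ) : ℝ) * m * (((ε : ℤ) : ℝ) * m) = (m : ℝ) * m := by
    linear_combination (m : ℝ) * m * hε
  rw [e1, e2]
  nlinarith [mul_le_mul_of_nonneg_left hcut hlam.le]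

/-- If a block is not constant, flipping the spins of a nonempty minority makes it so. -/
lemma exists_flipBlock_const (b : Fin B) (x : Config p) {y y' : Bool × Fin m}
    (h : x (e (b, y)) ≠ x (e (b, y'))) :
    ∃ T : Finset (Bool × Fin m), T.Nonempty ∧ #T ≤ m ∧
      ∃ ε, ∀ z, flipBlock e b T x (e (b, z)) = ε := by
  classical
  have hflip : ∀ (T : Finset (Bool × Fin m)) z, flipBlock e b T x (e (b, z))
      = if z ∈ T then -x (e (b, z)) else x (e (b, z)) := by
    intro T z
    have h : (∃ w ∈ T, e (b, z) = e (b, w)) ↔ z ∈ T := by simp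
    simp only [flipBlock, h]
  have hne : ∀ ε : ℤˣ, ({z | x (e (b, z)) = ε} : Finset (Bool × Fin m)).Nonempty := by
    intro ε
    rcases Int.units_eq_one_or ε with rfl | rfl <;>
    rcases Int.units_eq_one_or (x (e (b, y))) with h1 | h1 <;>
    rcases Int.units_eq_one_or (x (e (b, y'))) with h2 | h2 <;>
    first
      | exact absurd (h1.trans h2.symm) h
      | exact ⟨y, Finset.mem_filter.2 ⟨Finset.mem_univ _, h1⟩⟩
      | exact ⟨y', Finset.mem_filter.2 ⟨Finset.mem_univ _, h2⟩⟩
  have hconst : ∀ ε : ℤˣ, ∀ z, flipBlock e b ({z | x (e (b, z)) = ε}) x (e (b, z)) = -ε := by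
    intro ε z
    rw [hflip]
    by_cases hz : x (e (b, z)) = ε
    · simp [hz]
    · have : x (e (b, z)) = -ε := by
        rcases Int.units_eq_one_or ε with rfl | rfl <;>
        rcases Int.units_eq_one_or (x (e (b, z))) with h1 | h1 <;> simp_all
      simp [this]
  have hsum : #({z | x (e (b, z)) = 1} : Finset (Bool × Fin m))
      + #({z | x (e (b, z)) = -1} : Finset (Bool × Fin m)) ≤ 2 * m := by
    rw [← Finset.card_union_of_disjoint]
    · refine (Finset.card_le_univ _).trans ?_
      simp
    · refine Finset.disjoint_left.2 fun z h1 h2 => ?_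
      simp only [Finset.mem_filter, Finset.mem_univ, true_and] at h1 h2
      rw [h1] at h2
      exact absurd h2 (by decide)
  rcases le_or_gt #({z | x (e (b, z)) = 1} : Finset (Bool × Fin m)) m with hle | hgt
  · exact ⟨_, hne 1, hle, _, hconst 1⟩
  · exact ⟨_, hne (-1), by omega, _, hconst (-1)⟩

/-- A Peierls-type bound: two spins of the same copy of `K_{m,m}` are unlikely to disagree. -/
lemma one_sub_corr_crossEdges_le {lam : ℝ} (hlam : 0 < lam) (b : Fin B) (y y' : Bool × Fin m) :
    1 - corr lam (SimpleGraph.fromEdgeSet (crossEdges e : Set (Sym2 (Fin p))))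
        s(e (b, y), e (b, y'))
      ≤ 2 * ((1 + Real.exp (-(lam * m))) ^ (2 * m) - 1) := by
  classical
  set G := SimpleGraph.fromEdgeSet (crossEdges e : Set (Sym2 (Fin p))) with hG
  set v := Real.exp (-(lam * m)) with hv
  have hprob : ∀ (T : Finset (Bool × Fin m)) x, #T ≤ m →
      (∃ ε, ∀ z, flipBlock e b T x (e (b, z)) = ε) →
      isingProb lam G x ≤ v ^ #T * isingProb lam G (flipBlock e b T x) := by
    rintro T x hT ⟨ε, hε⟩
    have h := exponent_le_of_flipBlock_const e hlam b hT x ε hε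
    rw [isingProb, isingProb, ← mul_div_assoc]
    refine div_le_div_of_nonneg_right ?_ (partitionFunction_pos lam G).le
    rw [hv, ← Real.exp_nat_mul, ← Real.exp_add]
    refine Real.exp_le_exp.2 (h.trans_eq ?_)
    ring
  have hpt : ∀ x, isingProb lam G x * (1 - edgeSpin x s(e (b, y), e (b, y')))
      ≤ 2 * ∑ T ∈ (univ : Finset (Finset (Bool × Fin m))).erase ∅,
          v ^ #T * isingProb lam G (flipBlock e b T x) := by
    intro x
    have hterm : ∀ T ∈ (univ : Finset (Finset (Bool × Fin m))).erase ∅,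
        0 ≤ v ^ #T * isingProb lam G (flipBlock e b T x) := fun T _ =>
      mul_nonneg (by positivity) (isingProb_pos _ _ _).le
    by_cases hxy : x (e (b, y)) = x (e (b, y'))
    · have h1 : edgeSpin x s(e (b, y), e (b, y')) = 1 := by
        rw [edgeSpin_mk, ← spin_mul_self x (e (b, y))]
        simp only [spin, hxy]
      rw [h1, sub_self, mul_zero]
      exact mul_nonneg (by norm_num) (Finset.sum_nonneg hterm)
    · obtain ⟨T, hTne, hTm, hε⟩ := exists_flipBlock_const e b x hxy
      have h1 := Finset.single_le_sum hterm
        (Finset.mem_erase.2 ⟨hTne.ne_empty, Finset.mem_univ T⟩)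
      have h2 := hprob T x hTm hε
      have h3 : -1 ≤ edgeSpin x s(e (b, y), e (b, y')) := neg_one_le_edgeSpin _ _
      have := (isingProb_pos lam G x).le
      nlinarith
  have hcorr : 1 - corr lam G s(e (b, y), e (b, y'))
      = ∑ x, isingProb lam G x * (1 - edgeSpin x s(e (b, y), e (b, y'))) := by
    simp only [mul_sub, mul_one, Finset.sum_sub_distrib, sum_isingProb]
    rfl
  rw [hcorr]
  refine (Finset.sum_le_sum fun x _ => hpt x).trans_eq ?_
  rw [← Finset.mul_sum, Finset.sum_comm]
  congr 1
  have hflip : ∀ T : Finset (Bool × Fin m),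
      ∑ x, v ^ #T * isingProb lam G (flipBlock e b T x) = v ^ #T := by
    intro T
    have h := Equiv.sum_comp (flipBlock_involutive e b T).toPerm fun x => isingProb lam G x
    simp only [Function.Involutive.coe_toPerm] at h
    rw [← Finset.mul_sum, h, sum_isingProb, mul_one]
  simp only [hflip]
  have hpow := Fintype.sum_pow_mul_eq_add_pow (Bool × Fin m) v 1
  simp only [one_pow, mul_one] at hpow
  rw [← Finset.add_sum_erase _ _ (Finset.mem_univ ∅)] at hpow
  have hcard : Fintype.card (Bool × Fin m) = 2 * m := by simp
  rw [hcard, Finset.card_empty, pow_zero, add_comm v 1] at hpow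
  linarith

lemma one_sub_corr_crossEdges_le_exp {lam : ℝ} (hlam : 0 < lam) {d : ℕ} (hd : 2 < d)
    (hm : d ≤ 2 * m) (hm' : 2 * m ≤ d + 1) (b : Fin B) (y y' : Bool × Fin m) :
    1 - corr lam (SimpleGraph.fromEdgeSet (crossEdges e : Set (Sym2 (Fin p))))
        s(e (b, y), e (b, y'))
      ≤ 3 * (d : ℝ) ^ 2 * Real.exp (-(lam * ((d : ℝ) - 2) / 4)) := by
  set u := Real.exp (-(lam * ((d : ℝ) - 2) / 4)) with hu
  have hu0 : 0 < u := Real.exp_pos _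
  have hd3 : (3 : ℝ) ≤ d := by exact_mod_cast hd
  have hmR : (d : ℝ) ≤ 2 * m := by exact_mod_cast hm
  have hmR' : 2 * (m : ℝ) ≤ d + 1 := by exact_mod_cast hm'
  rcases le_or_gt 1 ((d : ℝ) ^ 2 * u) with hbig | hsmall
  · have h1 := neg_one_le_corr lam
      (SimpleGraph.fromEdgeSet (crossEdges e : Set (Sym2 (Fin p)))) s(e (b, y), e (b, y'))
    nlinarith
  · have h := one_sub_corr_crossEdges_le e hlam b y y'
    set v := Real.exp (-(lam * m)) with hv
    have hv0 : 0 < v := Real.exp_pos _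
    have hvu : v ≤ u * u := by
      rw [hu, hv, ← Real.exp_add]
      refine Real.exp_le_exp.2 ?_
      nlinarith
    have hpow : (1 + v) ^ (2 * m) ≤ Real.exp (2 * m * v) := by
      have h1 : 1 + v ≤ Real.exp v := by linarith [Real.add_one_le_exp v]
      calc (1 + v) ^ (2 * m) ≤ Real.exp v ^ (2 * m) := by gcongr
        _ = Real.exp (2 * m * v) := by rw [← Real.exp_nat_mul]; push_cast; rfl
    have hdu : (d : ℝ) * u ≤ 1 := by nlinarith
    have hmv : 2 * m * v ≤ (d + 1) * (u * u) := by
      have : (d + 1) * v ≤ (d + 1) * (u * u) := by gcongr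
      nlinarith
    have hu1 : (d + 1) * u ≤ 2 := by nlinarith
    have hu3 : 3 * u ≤ 1 := by nlinarith
    have hmv1 : 2 * m * v ≤ 1 := by nlinarith
    have hexp := Real.abs_exp_sub_one_le (x := 2 * m * v)
      (by rw [abs_of_nonneg (by positivity)]; exact hmv1)
    rw [abs_of_nonneg (a := 2 * (m : ℝ) * v) (by positivity)] at hexp
    have hexp' := (le_abs_self _).trans hexp
    have hfin : 4 * ((d + 1) * (u * u)) ≤ 3 * (d : ℝ) ^ 2 * u := by
      have h9 : (9 : ℝ) ≤ (d : ℝ) ^ 2 := by nlinarith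
      nlinarith
    linarith

/-- Fano's inequality for the ensemble of graphs between disjoint copies of `K_{m,m}` and the
cliques on the same vertices. -/
theorem fano_dense (e : Fin B × Bool × Fin m ↪ Fin p) {n k d : ℕ} {lam : ℝ} (hlam : 0 < lam) (hd : 2 < d)
    (hm : d ≤ 2 * m) (hm' : 2 * m ≤ d + 1) (hk : B * (m * (2 * m - 1)) ≤ k)
    (q : ℕ) (dec : Decoder p n) {δ x N₀ D : ℝ}
    (hx : 0 < x) (hx2 : x < 1 / 2) (hq : (q : ℝ) ≤ x * N₀) (hD : 0 ≤ D)
    (hN : N₀ ≤ (B * (m * (m - 1)) : ℕ) + D)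
    (herr : maxErrorProb k d lam q dec ≤ δ) :
    (B * (m * (m - 1)) : ℕ) * (Real.log 2 - Real.binEntropy x) * (1 - δ)
        - (D + 1) * Real.log 2 ≤
      n * (lam * ((B * (m * (m - 1)) : ℕ) *
        (3 * (d : ℝ) ^ 2 * Real.exp (-(lam * ((d : ℝ) - 2) / 4))))) := by
  classical
  have h := fano_ensemble (k := k) (d := d) (crossEdges e) (sideEdges e)
    (not_isDiag_of_mem_blocks e) (disjoint_crossEdges_sideEdges e)
    (blocks_mem_graphClass e hk (by omega)) lam q dec
    (κ := lam * ((B * (m * (m - 1)) : ℕ) *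
        (3 * (d : ℝ) ^ 2 * Real.exp (-(lam * ((d : ℝ) - 2) / 4)))))
    hx hx2 hq hD (by rw [card_sideEdges]; exact hN) (by
      intro S hS
      refine (klDiv_le_sum_corr lam (fun a ha => not_isDiag_of_mem_blocks e a
        (Finset.union_subset_union_right hS ha))
        ((disjoint_crossEdges_sideEdges e).mono_right hS)).trans
        (mul_le_mul_of_nonneg_left ?_ hlam.le)
      refine (Finset.sum_le_card_nsmul _ _
        (3 * (d : ℝ) ^ 2 * Real.exp (-(lam * ((d : ℝ) - 2) / 4))) fun a ha => ?_).trans ?_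
      · obtain ⟨b, s, u, u', -, rfl⟩ := exists_of_mem_sideEdges e (hS ha)
        refine (sub_le_sub_right (corr_le_one _ _ _) _).trans ?_
        exact one_sub_corr_crossEdges_le_exp e hlam hd hm hm' b (s, u) (s, u')
      · rw [nsmul_eq_mul, ← card_sideEdges e]
        refine mul_le_mul_of_nonneg_right ?_ (by positivity)
        exact_mod_cast Finset.card_le_card hS) herr
  rw [card_sideEdges] at h
  exact h

end Blocks

end IsingSelection

/-! ### Sample complexity -/

namespace IsingSelection

open Finset

/-- Dividing Fano's inequality by the information `N * I` per sample. -/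
lemma div_mul_le_of_fano {c I N E r δ n : ℝ} (hI : 0 < I) (hN : 0 < N)
    (h : N * c * (1 - δ) - E ≤ n * (N * I)) (hr : E ≤ N * (c * r)) :
    c / I * (1 - δ - r) ≤ n := by
  rw [div_mul_eq_mul_div, div_le_iff₀ hI]
  refine le_of_mul_le_mul_left ?_ hN
  linarith

/-- The `k` available edges build `B = ⌊k / (m (2m - 1))⌋` cliques on `2 * m` vertices, where
`m = ⌊(d + 1) / 2⌋`. These fit into `p` vertices, and of their edges about `k (d - 2) / (2 d)`, up
to the rounding of `B`, do not cross between the two halves of a clique. -/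
lemma exists_blocks {p k d d' : ℕ} (hd : 2 < d) (hd' : d' ≤ d)
    (hkp : (k : ℝ) ≤ (1 / 2 : ℝ) * (p : ℝ) * ((d' : ℝ) - 1)) :
    ∃ B m : ℕ, d ≤ 2 * m ∧ 2 * m ≤ d + 1 ∧ B * (m * (2 * m - 1)) ≤ k ∧ B * (2 * m) ≤ p ∧
      (k : ℝ) * (((d : ℝ) - 2) / (2 * d)) ≤ (B * (m * (m - 1)) : ℕ) + (d : ℝ) ^ 2 := by
  obtain ⟨m, hm⟩ : ∃ m, m = (d + 1) / 2 := ⟨_, rfl⟩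
  obtain ⟨B, hB⟩ : ∃ B, B = k / (m * (2 * m - 1)) := ⟨_, rfl⟩
  have hm1 : d ≤ 2 * m := by omega
  have hm2 : 2 * m ≤ d + 1 := by omega
  have hBk : B * (m * (2 * m - 1)) ≤ k := hB ▸ Nat.div_mul_le_self _ _
  have hd3 : (3 : ℝ) ≤ d := by exact_mod_cast hd
  have hm1R : (d : ℝ) ≤ 2 * m := by exact_mod_cast hm1
  have hm2R : 2 * (m : ℝ) ≤ d + 1 := by exact_mod_cast hm2
  have hc1 : (((2 * m - 1 : ℕ)) : ℝ) = 2 * m - 1 := by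
    rw [Nat.cast_sub (by omega)]; push_cast; ring
  have hc2 : (((m - 1 : ℕ)) : ℝ) = m - 1 := by
    rw [Nat.cast_sub (by omega)]; push_cast; ring
  have hBkR : (B : ℝ) * (m * (2 * m - 1)) ≤ k := by
    have h : ((B * (m * (2 * m - 1)) : ℕ) : ℝ) ≤ k := by exact_mod_cast hBk
    rw [← hc1]; push_cast at h ⊢; exact h
  have hBkR' : (k : ℝ) ≤ (B + 1) * (m * (2 * m - 1)) := by
    have h : k ≤ (B + 1) * (m * (2 * m - 1)) := by
      have hpos : 0 < m * (2 * m - 1) := Nat.mul_pos (by omega) (by omega)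
      exact (Nat.lt_mul_of_div_lt (hB ▸ Nat.lt_succ_self _) hpos).le
    have h' : (k : ℝ) ≤ (((B + 1) * (m * (2 * m - 1)) : ℕ) : ℝ) := by exact_mod_cast h
    rw [← hc1]; push_cast at h' ⊢; exact h'
  refine ⟨B, m, hm1, hm2, hBk, ?_, ?_⟩
  · have hdR : (d' : ℝ) ≤ d := by exact_mod_cast hd'
    have h1 : (B : ℝ) * (m * (2 * m - 1)) ≤ 1 / 2 * p * (2 * m - 1) := by
      refine (hBkR.trans hkp).trans ?_
      gcongr
      linarith
    have h2 : (B : ℝ) * (2 * m) ≤ p := by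
      refine le_of_mul_le_mul_right ?_ (show (0 : ℝ) < 2 * m - 1 by linarith)
      linarith
    exact_mod_cast h2
  · have h1 : ((d : ℝ) - 2) / (2 * d) ≤ (m - 1) / (2 * m - 1) := by
      rw [div_le_div_iff₀ (by linarith) (by linarith)]
      nlinarith
    have h2 : (k : ℝ) * ((m - 1) / (2 * m - 1)) ≤ (B + 1) * (m * (m - 1)) := by
      rw [← mul_div_assoc, div_le_iff₀ (by linarith)]
      have := mul_le_mul_of_nonneg_right hBkR' (show (0 : ℝ) ≤ m - 1 by linarith)
      linarith
    have h3 := mul_le_mul_of_nonneg_left h1 (Nat.cast_nonneg (α := ℝ) k)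
    have h4 : (m : ℝ) * (m - 1) ≤ (d : ℝ) ^ 2 := by nlinarith
    push_cast
    rw [hc2]
    linarith

/-- The bound from the ensemble between disjoint copies of `K_{m,m}` and disjoint cliques. -/
theorem dense_bound {p n k d d' : ℕ} (hd : 2 < d) (hd' : d' ≤ d)
    (hkp : (k : ℝ) ≤ (1 / 2 : ℝ) * (p : ℝ) * ((d' : ℝ) - 1))
    {θ lam δ c₀ : ℝ} (hθ : 0 < θ) (hlam : 0 < lam)
    (hx2 : (d : ℝ) / ((d : ℝ) - 2) * (2 * θ) < 1 / 2) (hc₀ : 0 < c₀)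
    (hc : c₀ ≤ Real.log 2 - Real.binEntropy ((d : ℝ) / ((d : ℝ) - 2) * (2 * θ)))
    (ht : 6 < (k : ℝ) / (d : ℝ) ^ 2) (dec : Decoder p n)
    (herr : maxErrorProb k d lam ⌊θ * (k : ℝ)⌋₊ dec ≤ δ) :
    Real.exp (lam * ((d : ℝ) - 2) / 4) *
        (Real.log 2 - Real.binEntropy ((d : ℝ) / ((d : ℝ) - 2) * (2 * θ))) /
      (3 * lam * (d : ℝ) ^ 2) *
      (1 - δ - 2 * Real.log 2 / (((k : ℝ) / (d : ℝ) ^ 2 / 6 - 1) * c₀)) ≤ n := by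
  obtain ⟨B, m, hm1, hm2, hBk, hfit, hN₀N⟩ := exists_blocks hd hd' hkp
  have hd3 : (3 : ℝ) ≤ d := by exact_mod_cast hd
  have hd2 : (0 : ℝ) < d - 2 := by linarith
  have hd0 : (0 : ℝ) < d := by linarith
  have hk0 : 6 * (d : ℝ) ^ 2 < k := by rwa [lt_div_iff₀ (by positivity)] at ht
  obtain ⟨e⟩ : Nonempty (Fin B × Bool × Fin m ↪ Fin p) := by
    rw [Function.Embedding.nonempty_iff_card_le]
    simpa [mul_comm, mul_left_comm] using hfit
  have hN6 : (k : ℝ) / 6 ≤ k * (((d : ℝ) - 2) / (2 * d)) := by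
    rw [div_eq_mul_one_div]
    refine mul_le_mul_of_nonneg_left ?_ (Nat.cast_nonneg k)
    rw [div_le_div_iff₀ (by norm_num) (by linarith)]
    linarith
  have hq : ((⌊θ * (k : ℝ)⌋₊ : ℕ) : ℝ)
      ≤ (d : ℝ) / ((d : ℝ) - 2) * (2 * θ) * (k * (((d : ℝ) - 2) / (2 * d))) := by
    refine (floor_mul_le hθ k).trans (le_of_eq ?_)
    field_simp
  have hfano := fano_dense e hlam hd hm1 hm2 hBk ⌊θ * (k : ℝ)⌋₊ dec
    (mul_pos (div_pos hd0 hd2) (by linarith)) hx2 hq (by positivity) hN₀N herr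
  set c := Real.log 2 - Real.binEntropy ((d : ℝ) / ((d : ℝ) - 2) * (2 * θ)) with hcdef
  generalize ((B * (m * (m - 1)) : ℕ) : ℝ) = N at hfano hN₀N
  have hNpos : 0 < N := by linarith
  have hI : Real.exp (lam * ((d : ℝ) - 2) / 4) * c / (3 * lam * (d : ℝ) ^ 2)
      = c / (lam * (3 * (d : ℝ) ^ 2 * Real.exp (-(lam * ((d : ℝ) - 2) / 4)))) := by
    rw [Real.exp_neg]
    have := (Real.exp_pos (lam * ((d : ℝ) - 2) / 4)).ne'
    field_simp
  rw [hI]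
  refine div_mul_le_of_fano (by positivity) hNpos (hfano.trans_eq (by ring)) ?_
  have hlog2 : 0 < Real.log 2 := Real.log_pos (by norm_num)
  have htd : (d : ℝ) ^ 2 * ((k : ℝ) / (d : ℝ) ^ 2 / 6 - 1) = k / 6 - (d : ℝ) ^ 2 := by
    field_simp
  have ht6 : 0 < (k : ℝ) / (d : ℝ) ^ 2 / 6 - 1 := by linarith
  generalize (k : ℝ) / (d : ℝ) ^ 2 / 6 - 1 = t at htd ht6
  calc ((d : ℝ) ^ 2 + 1) * Real.log 2 ≤ (2 * (d : ℝ) ^ 2) * Real.log 2 := by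
        gcongr; nlinarith
    _ = ((d : ℝ) ^ 2 * t) * (c₀ * (2 * Real.log 2 / (t * c₀))) := by
        field_simp
    _ ≤ N * (c * (2 * Real.log 2 / (t * c₀))) := by
        gcongr
        linarith

/-- The bound from the subgraphs of a single graph with `k` edges and degrees at most `d'`. -/
theorem sparse_bound {p n k d d' : ℕ} (hd : 2 < d) (hd' : d' ≤ d)
    (hkp : (k : ℝ) ≤ (1 / 2 : ℝ) * (p : ℝ) * ((d' : ℝ) - 1))
    {θ lam δ : ℝ} (hθ : 0 < θ) (hθ2 : θ < 1 / 2) (hlam : 0 < lam)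
    (ht : 6 < (k : ℝ) / (d : ℝ) ^ 2) (dec : Decoder p n)
    (herr : maxErrorProb k d lam ⌊θ * (k : ℝ)⌋₊ dec ≤ δ) :
    (Real.log 2 - Real.binEntropy θ) /
      (lam * ((Real.exp (2 * lam) * Real.cosh (2 * lam * (d' : ℝ)) - 1) /
        (Real.exp (2 * lam) * Real.cosh (2 * lam * (d' : ℝ)) + 1))) *
      (1 - δ - Real.log 2 / ((k : ℝ) / (d : ℝ) ^ 2 * (Real.log 2 - Real.binEntropy θ))) ≤ n := by
  have hd3 : (3 : ℝ) ≤ d := by exact_mod_cast hd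
  have hdR : (d' : ℝ) ≤ d := by exact_mod_cast hd'
  have hk0 : 6 * (d : ℝ) ^ 2 < k := by rwa [lt_div_iff₀ (by positivity)] at ht
  have hkpos : (0 : ℝ) < k := by nlinarith
  have hp : d' < p := by
    have h1 : 6 * (d : ℝ) ^ 2 < 1 / 2 * p * d := by
      have : (1 / 2 : ℝ) * p * (d' - 1) ≤ 1 / 2 * p * d := by gcongr; linarith
      linarith
    have h2 : 6 * (d : ℝ) < 1 / 2 * p := by
      refine lt_of_mul_lt_mul_right ?_ (show (0 : ℝ) ≤ d by linarith)
      linarith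
    have h3 : (d' : ℝ) < p := by linarith
    exact_mod_cast h3
  have hk : k ≤ p * (d' / 2) := by
    have h1 : (d' : ℝ) - 1 ≤ 2 * ((d' / 2 : ℕ) : ℝ) := by
      have : d' ≤ 2 * (d' / 2) + 1 := by omega
      have : (d' : ℝ) ≤ 2 * ((d' / 2 : ℕ) : ℝ) + 1 := by exact_mod_cast this
      linarith
    have h2 : (k : ℝ) ≤ p * ((d' / 2 : ℕ) : ℝ) := by
      have := mul_le_mul_of_nonneg_left h1 (show (0 : ℝ) ≤ 1 / 2 * p by positivity)
      linarith
    exact_mod_cast h2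
  have hfano := fano_sparse hp hd' hk hθ hθ2 hlam dec herr
  have hc : 0 < Real.log 2 - Real.binEntropy θ :=
    sub_pos.2 (Real.binEntropy_lt_log_two.2 (by rw [← one_div]; exact hθ2.ne))
  have hI : 0 < lam * ((Real.exp (2 * lam) * Real.cosh (2 * lam * (d' : ℝ)) - 1) /
        (Real.exp (2 * lam) * Real.cosh (2 * lam * (d' : ℝ)) + 1)) := by
    have h1 : 1 < Real.exp (2 * lam) := Real.one_lt_exp_iff.2 (by positivity)
    have h2 := Real.one_le_cosh (2 * lam * (d' : ℝ))
    exact mul_pos hlam (div_pos (by nlinarith) (by nlinarith))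
  refine div_mul_le_of_fano hI hkpos (hfano.trans_eq (by ring)) ?_
  have hlog2 : 0 < Real.log 2 := Real.log_pos (by norm_num)
  set c := Real.log 2 - Real.binEntropy θ with hcdef
  have h1 : (k : ℝ) * (c * (Real.log 2 / (k / (d : ℝ) ^ 2 * c))) = (d : ℝ) ^ 2 * Real.log 2 := by
    have : (d : ℝ) ≠ 0 := by linarith
    field_simp
  have h2 : 1 ≤ (d : ℝ) ^ 2 := by nlinarith
  rw [h1]
  exact le_mul_of_one_le_left hlog2.le h2

/-- The entropy gap of the dense ensemble is bounded below for all admissible degrees: the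
smallest admissible degree is the worst. -/
lemma exists_entropy_gap {θ : ℝ} (hθ : 0 < θ)
    (hex : ∃ d : ℕ, 2 < d ∧ θ < (1 / 4 : ℝ) * (((d : ℝ) - 2) / (d : ℝ))) :
    ∃ c₀ : ℝ, 0 < c₀ ∧ ∀ d : ℕ, 2 < d → θ < (1 / 4 : ℝ) * (((d : ℝ) - 2) / (d : ℝ)) →
      (d : ℝ) / ((d : ℝ) - 2) * (2 * θ) < 1 / 2 ∧
      c₀ ≤ Real.log 2 - Real.binEntropy ((d : ℝ) / ((d : ℝ) - 2) * (2 * θ)) := by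
  classical
  have hlt : ∀ d : ℕ, 2 < d → θ < (1 / 4 : ℝ) * (((d : ℝ) - 2) / (d : ℝ)) →
      (d : ℝ) / ((d : ℝ) - 2) * (2 * θ) < 1 / 2 := by
    intro d hd h
    have hd3 : (3 : ℝ) ≤ d := by exact_mod_cast hd
    rw [← mul_div_assoc, lt_div_iff₀ (by linarith)] at h
    rw [div_mul_eq_mul_div, div_lt_iff₀ (by linarith)]
    linarith
  obtain ⟨hd₀, hθ₀⟩ := Nat.find_spec hex
  set d₀ := Nat.find hex with hd₀def
  refine ⟨_, sub_pos.2 (Real.binEntropy_lt_log_two.2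
    (by rw [← one_div]; exact (hlt d₀ hd₀ hθ₀).ne)), fun d hd h => ⟨hlt d hd h, ?_⟩⟩
  have hd₀d : d₀ ≤ d := Nat.find_min' hex ⟨hd, h⟩
  have hd₀3 : (3 : ℝ) ≤ d₀ := by exact_mod_cast hd₀
  have hR : (d₀ : ℝ) ≤ d := by exact_mod_cast hd₀d
  have hmono : (d : ℝ) / ((d : ℝ) - 2) * (2 * θ) ≤ (d₀ : ℝ) / ((d₀ : ℝ) - 2) * (2 * θ) := by
    refine mul_le_mul_of_nonneg_right ?_ (by positivity)
    rw [div_le_div_iff₀ (by linarith) (by linarith)]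
    linarith
  have hpos : 0 ≤ (d : ℝ) / ((d : ℝ) - 2) * (2 * θ) :=
    mul_nonneg (div_nonneg (by linarith) (by linarith)) (by positivity)
  refine sub_le_sub_left (Real.binEntropy_strictMonoOn.monotoneOn ⟨hpos, ?_⟩
    ⟨hpos.trans hmono, ?_⟩ hmono) _
  · rw [← one_div]; exact (hlt d hd h).le
  · rw [← one_div]; exact (hlt d₀ hd₀ hθ₀).le

end IsingSelection

theorem theorem4 (θ : ℝ) (hθ : 0 < θ) (k d d' : ℕ → ℕ)
    (hd : ∀ᶠ p : ℕ in atTop, 2 < d p)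
    (hθd : ∀ᶠ p : ℕ in atTop, θ < (1 / 4 : ℝ) * (((d p : ℝ) - 2) / (d p : ℝ)))
    (hkd : Tendsto (fun p : ℕ => (k p : ℝ) / (d p : ℝ) ^ 2) atTop atTop)
    (hd' : ∀ᶠ p : ℕ in atTop, d' p ≤ d p)
    (hkp : ∀ᶠ p : ℕ in atTop, (k p : ℝ) ≤ (1 / 2 : ℝ) * (p : ℝ) * ((d' p : ℝ) - 1)) :
    ∃ r : ℕ → ℝ, Tendsto r atTop (𝓝 0) ∧
      ∀ᶠ p : ℕ in atTop, ∀ (lam : ℝ), 0 < lam →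
        ∀ (δ : ℝ) (n : ℕ) (dec : IsingSelection.Decoder p n),
          IsingSelection.maxErrorProb (k p) (d p) lam ⌊θ * (k p : ℝ)⌋₊ dec ≤ δ →
          max
            (Real.exp (lam * ((d p : ℝ) - 2) / 4) *
                (Real.log 2 - Real.binEntropy ((d p : ℝ) / ((d p : ℝ) - 2) * (2 * θ))) /
              (3 * lam * (d p : ℝ) ^ 2))
            ((Real.log 2 - Real.binEntropy θ) /
              (lam * ((Real.exp (2 * lam) * Real.cosh (2 * lam * (d' p : ℝ)) - 1) /
                (Real.exp (2 * lam) * Real.cosh (2 * lam * (d' p : ℝ)) + 1)))) *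
            (1 - δ - r p) ≤ (n : ℝ) := by
  obtain ⟨c₀, hc₀, hgap⟩ := IsingSelection.exists_entropy_gap hθ
    ((hd.and hθd).exists.imp' d fun _ h => h)
  have hθ4 : θ < 1 / 4 := by
    obtain ⟨p, hp, hp'⟩ := (hd.and hθd).exists
    have hd3 : (3 : ℝ) ≤ d p := by exact_mod_cast hp
    have : ((d p : ℝ) - 2) / d p ≤ 1 := by
      rw [div_le_one (by linarith)]; linarith
    linarith
  have hlog2 : 0 < Real.log 2 := Real.log_pos (by norm_num)
  have hc : 0 < Real.log 2 - Real.binEntropy θ :=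
    sub_pos.2 (Real.binEntropy_lt_log_two.2 (by rw [← one_div]; linarith))
  have hlim1 : Tendsto (fun p : ℕ => 2 * Real.log 2 /
      (((k p : ℝ) / (d p : ℝ) ^ 2 / 6 - 1) * c₀)) atTop (𝓝 0) :=
    (((tendsto_atTop_add_const_right _ (-1) (hkd.atTop_div_const (by norm_num))).atTop_mul_const
      hc₀).const_div_atTop _)
  have hlim2 : Tendsto (fun p : ℕ => Real.log 2 /
      ((k p : ℝ) / (d p : ℝ) ^ 2 * (Real.log 2 - Real.binEntropy θ))) atTop (𝓝 0) :=
    (hkd.atTop_mul_const hc).const_div_atTop _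
  refine ⟨_, by simpa using hlim1.add hlim2, ?_⟩
  filter_upwards [hd, hθd, hd', hkp, hkd.eventually_gt_atTop 6]
    with p hd hθd hd' hkp ht lam hlam δ n dec herr
  obtain ⟨hx2, hcd⟩ := hgap (d p) hd hθd
  have h1 := IsingSelection.dense_bound hd hd' hkp hθ hlam hx2 hc₀ hcd ht dec herr
  have h2 := IsingSelection.sparse_bound hd hd' hkp hθ (by linarith) hlam ht dec herr
  have hr1 : 0 ≤ 2 * Real.log 2 / (((k p : ℝ) / (d p : ℝ) ^ 2 / 6 - 1) * c₀) :=
    div_nonneg (by positivity) (mul_nonneg (by linarith) hc₀.le)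
  have hr2 : 0 ≤ Real.log 2 /
      ((k p : ℝ) / (d p : ℝ) ^ 2 * (Real.log 2 - Real.binEntropy θ)) :=
    div_nonneg hlog2.le (mul_nonneg (by linarith) hc.le)
  have hA1 : 0 ≤ Real.exp (lam * ((d p : ℝ) - 2) / 4) *
      (Real.log 2 - Real.binEntropy ((d p : ℝ) / ((d p : ℝ) - 2) * (2 * θ))) /
      (3 * lam * (d p : ℝ) ^ 2) :=
    div_nonneg (mul_nonneg (Real.exp_pos _).le (hc₀.le.trans hcd)) (by positivity)
  have hA2 : 0 ≤ (Real.log 2 - Real.binEntropy θ) /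
      (lam * ((Real.exp (2 * lam) * Real.cosh (2 * lam * (d' p : ℝ)) - 1) /
        (Real.exp (2 * lam) * Real.cosh (2 * lam * (d' p : ℝ)) + 1))) := by
    have h3 : 1 < Real.exp (2 * lam) := Real.one_lt_exp_iff.2 (by positivity)
    have h4 := Real.one_le_cosh (2 * lam * (d' p : ℝ))
    exact div_nonneg hc.le (mul_nonneg hlam.le (div_nonneg (by nlinarith) (by nlinarith)))
  rcases le_total (1 - δ - (2 * Real.log 2 / (((k p : ℝ) / (d p : ℝ) ^ 2 / 6 - 1) * c₀) +
      Real.log 2 / ((k p : ℝ) / (d p : ℝ) ^ 2 * (Real.log 2 - Real.binEntropy θ)))) 0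
    with hs | hs
  · exact (mul_nonpos_of_nonneg_of_nonpos (le_max_of_le_left hA1) hs).trans (Nat.cast_nonneg n)
  · rw [max_mul_of_nonneg _ _ hs]
    exact max_le ((mul_le_mul_of_nonneg_left (by linarith) hA1).trans h1)
      ((mul_le_mul_of_nonneg_left (by linarith) hA2).trans h2)
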